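/- Let $(M,g)$ be a smooth Riemannian manifold of dimension $d$ (without boundary) with Levi-Civita connection $\nabla$ and Riemannian volume measure $\mu_g$, and let $V$ be a smooth vector field on $M$. Assume that $V$ is \emph{cylindrical} with compact cross-section: there is a compact codimension one submanifold $Y \subset M$ (without boundary), transverse to $V$, such that the flow of $V$ defines a diffeomorphism $\mathbb{R} \times Y \simeq M$. Assume moreover that $g$ is $V$-linear of slope $1$, i.e. $\mathcal{L}_V g = g$, and that the endomorphism $\nabla V : TM \to TM$ is self-adjoint. Let $U(M;V)$ be the set of smooth positive functions $F : M \to \mathbb{R}$ with $VF = F$, and for $F \in U(M;V)$ put \[ S(F) := \int_{\{F \le 1\}} \Delta F \, d\mu_g , \qquad \Delta F = \operatorname{tr}(\nabla^2 F). \] Let $G, H \in U(M;V)$ have positive semi-definite Hessians $\nabla^2 G$ and $\nabla^2 H$, and suppose that $G \le H \le L \cdot G$ for a constant $L \ge 1$. Then $\Delta G$ and $\Delta H$ are integrable over $\{G \le 1\}$ and $\{H \le 1\}$ respectively, so that $S(G)$ and $S(H)$ are finite, and \[ S(H) \le \exp\left(\tfrac{1}{2} L d^2\right) \cdot S(G).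 \] -/

import Mathlib

open scoped ContDiff Manifold

set_option linter.unusedSectionVars false

noncomputable section

namespace LaplacianFunctional

open Bundle Manifold MeasureTheory VectorField

variable {E : Type*} [NormedAddCommGroup E] [NormedSpace ℝ E] [FiniteDimensional ℝ E]
  {H : Type*} [TopologicalSpace H] {I : ModelWithCorners ℝ E H}
  {M : Type*} [TopologicalSpace M] [ChartedSpace H M] [IsManifold I ∞ M]

/-- A smooth Riemannian metric on `M`. -/
abbrev SmoothMetric {E : Type*} [NormedAddCommGroup E] [NormedSpace ℝ E]
    {H : Type*} [TopologicalSpace H] (I : ModelWithCorners ℝ E H)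
    (M : Type*) [TopologicalSpace M] [ChartedSpace H M] [IsManifold I ∞ M] :=
  ContMDiffRiemannianMetric I ∞ E (TangentSpace I : M → Type _)

variable (g : SmoothMetric I M)

/-- The function `p ↦ g_p(X_p, Y_p)`. -/
def pairing (X Y : Π x : M, TangentSpace I x) : M → ℝ := fun p ↦ g.inner p (X p) (Y p)

lemma pairing_comm (X Y : Π x : M, TangentSpace I x) : pairing g X Y = pairing g Y X :=
  funext fun p ↦ g.symm p _ _

lemma mdifferentiableAt_pairing {X Y : Π x : M, TangentSpace I x} {p : M}
    (hX : MDiffAt (T% X) p) (hY : MDiffAt (T% Y) p) : MDiffAt (pairing g X Y) p := by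
  have h1 := g.contMDiff.mdifferentiableAt (x := p) (by simp)
  have : MDifferentiableAt I (I.prod 𝓘(ℝ))
      (fun m ↦ TotalSpace.mk' ℝ (E := Bundle.Trivial M ℝ) m (g.inner m (X m) (Y m))) p := by
    apply MDifferentiableAt.clm_bundle_apply₂ (F₁ := E) (F₂ := E)
    · exact h1
    · exact hX
    · exact hY
  simp only [mdifferentiableAt_totalSpace] at this
  exact this.2

/-- The isomorphism `T_pM ≃ T_p^*M`, `v ↦ g_p(v, ·)`. -/
def flat (p : M) : TangentSpace I p ≃ₗ[ℝ] (TangentSpace I p →L[ℝ] ℝ) :=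
  haveI : FiniteDimensional ℝ (TangentSpace I p) := inferInstanceAs (FiniteDimensional ℝ E)
  haveI : FiniteDimensional ℝ (TangentSpace I p →L[ℝ] ℝ) :=
    inferInstanceAs (FiniteDimensional ℝ (E →L[ℝ] ℝ))
  LinearMap.linearEquivOfInjective (g.inner p).toLinearMap
    (by
      rw [injective_iff_map_eq_zero]
      intro v hv
      by_contra h
      have h1 := g.pos p v h
      have h2 : g.inner p v v = 0 := by
        have := congrArg (fun f : TangentSpace I p →L[ℝ] ℝ ↦ f v) hv
        simpa using this
      exact absurd h2 h1.ne')
    (by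
      change Module.finrank ℝ E = Module.finrank ℝ (E →L[ℝ] ℝ)
      rw [← (LinearMap.toContinuousLinearMap (𝕜 := ℝ) (E := E) (F' := ℝ)).finrank_eq]
      exact (Subspace.dual_finrank_eq (K := ℝ) (V := E)).symm)

@[simp] lemma flat_apply (p : M) (v w : TangentSpace I p) :
    flat g p v w = g.inner p v w := rfl

@[simp] lemma inner_flat_symm (p : M) (f : TangentSpace I p →L[ℝ] ℝ)
    (w : TangentSpace I p) : g.inner p ((flat g p).symm f) w = f w := by
  rw [← flat_apply, LinearEquiv.apply_symm_apply]

lemma ext_inner (p : M) {v w : TangentSpace I p}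
    (h : ∀ u, g.inner p v u = g.inner p w u) : v = w :=
  (flat g p).injective (by ext u; exact h u)

/-- Half of the right-hand side of the Koszul formula, that is `g(∇_X Y, Z)` at `p`. -/
def koszul (X Y Z : Π x : M, TangentSpace I x) (p : M) : ℝ :=
  (mvfderiv I (pairing g Y Z) p (X p) + mvfderiv I (pairing g Z X) p (Y p)
    - mvfderiv I (pairing g X Y) p (Z p) + g.inner p (mlieBracket I X Y p) (Z p)
    - g.inner p (mlieBracket I Y Z p) (X p) + g.inner p (mlieBracket I Z X p) (Y p)) / 2

variable {X X' Y Y' Z Z' : Π x : M, TangentSpace I x} {p : M}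

lemma pairing_add_left : pairing g (X + X') Y = fun q ↦ pairing g X Y q + pairing g X' Y q := by
  ext q; simp [pairing]
lemma pairing_add_right : pairing g Y (X + X') = fun q ↦ pairing g Y X q + pairing g Y X' q := by
  ext q; simp [pairing]
lemma pairing_smul_left (f : M → ℝ) : pairing g (f • X) Y = fun q ↦ f q * pairing g X Y q := by
  ext q; simp [pairing]
lemma pairing_smul_right (f : M → ℝ) : pairing g Y (f • X) = fun q ↦ f q * pairing g Y X q := by
  ext q; simp [pairing]

lemma tensorialAt_koszul_left (hY : MDiffAt (T% Y) p) (hZ : MDiffAt (T% Z) p) :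
    TensorialAt I E (fun X ↦ koszul g X Y Z p) p where
  smul {f X} hf hX := by
    have hXY := mdifferentiableAt_pairing g hX hY
    have hZX := mdifferentiableAt_pairing g hZ hX
    simp only [koszul, pairing_smul_left, pairing_smul_right]
    rw [mvfderiv_fun_mul hf hZX, mvfderiv_fun_mul hf hXY, mlieBracket_smul_left hf hX,
      mlieBracket_smul_right hf hX]
    simp [pairing, g.symm p (X p)]
    ring
  add {X X'} hX hX' := by
    have hXY := mdifferentiableAt_pairing g hX hY
    have hZX := mdifferentiableAt_pairing g hZ hX
    have hXY' := mdifferentiableAt_pairing g hX' hY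
    have hZX' := mdifferentiableAt_pairing g hZ hX'
    simp only [koszul, pairing_add_left, pairing_add_right]
    rw [mvfderiv_fun_add hZX hZX', mvfderiv_fun_add hXY hXY', mlieBracket_add_left hX hX',
      mlieBracket_add_right hX hX']
    simp
    ring

lemma tensorialAt_koszul_right (hX : MDiffAt (T% X) p) (hY : MDiffAt (T% Y) p) :
    TensorialAt I E (fun Z ↦ koszul g X Y Z p) p where
  smul {f Z} hf hZ := by
    have hYZ := mdifferentiableAt_pairing g hY hZ
    have hZX := mdifferentiableAt_pairing g hZ hX
    simp only [koszul, pairing_smul_left, pairing_smul_right]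
    rw [mvfderiv_fun_mul hf hZX, mvfderiv_fun_mul hf hYZ, mlieBracket_smul_left hf hZ,
      mlieBracket_smul_right hf hZ]
    simp [pairing, g.symm p (Z p)]
    ring
  add {Z Z'} hZ hZ' := by
    have hYZ := mdifferentiableAt_pairing g hY hZ
    have hZX := mdifferentiableAt_pairing g hZ hX
    have hYZ' := mdifferentiableAt_pairing g hY hZ'
    have hZX' := mdifferentiableAt_pairing g hZ' hX
    simp only [koszul, pairing_add_left, pairing_add_right]
    rw [mvfderiv_fun_add hZX hZX', mvfderiv_fun_add hYZ hYZ', mlieBracket_add_left hZ hZ',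
      mlieBracket_add_right hZ hZ']
    simp
    ring

lemma koszul_add (hX : MDiffAt (T% X) p) (hY : MDiffAt (T% Y) p) (hY' : MDiffAt (T% Y') p)
    (hZ : MDiffAt (T% Z) p) :
    koszul g X (Y + Y') Z p = koszul g X Y Z p + koszul g X Y' Z p := by
  have hXY := mdifferentiableAt_pairing g hX hY
  have hYZ := mdifferentiableAt_pairing g hY hZ
  have hXY' := mdifferentiableAt_pairing g hX hY'
  have hYZ' := mdifferentiableAt_pairing g hY' hZ
  simp only [koszul, pairing_add_left, pairing_add_right]
  rw [mvfderiv_fun_add hYZ hYZ', mvfderiv_fun_add hXY hXY', mlieBracket_add_left hY hY',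
    mlieBracket_add_right hY hY']
  simp
  ring

lemma koszul_smul {f : M → ℝ} (hf : MDiffAt f p) (hX : MDiffAt (T% X) p)
    (hY : MDiffAt (T% Y) p) (hZ : MDiffAt (T% Z) p) :
    koszul g X (f • Y) Z p =
      f p * koszul g X Y Z p + mvfderiv I f p (X p) * g.inner p (Y p) (Z p) := by
  have hXY := mdifferentiableAt_pairing g hX hY
  have hYZ := mdifferentiableAt_pairing g hY hZ
  simp only [koszul, pairing_smul_left, pairing_smul_right]
  rw [mvfderiv_fun_mul hf hYZ, mvfderiv_fun_mul hf hXY, mlieBracket_smul_left hf hY,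
    mlieBracket_smul_right hf hY]
  simp [pairing, g.symm p (Y p)]
  ring

open Classical in
/-- `∇Y` at `p`, as an endomorphism of `T_pM`, defined by the Koszul formula. Fields that
are not differentiable at `p` get the value `0`. -/
def leviCivitaAux (Y : Π x : M, TangentSpace I x) (p : M) :
    TangentSpace I p →L[ℝ] TangentSpace I p :=
  if hY : MDiffAt (T% Y) p then
    haveI : FiniteDimensional ℝ (TangentSpace I p →L[ℝ] ℝ) :=
      inferInstanceAs (FiniteDimensional ℝ (E →L[ℝ] ℝ))
    (LinearMap.toContinuousLinearMap (flat g p).symm.toLinearMap).comp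
      (TensorialAt.mkHom₂ (fun X Z ↦ koszul g X Y Z p) p
        (fun _ hZ ↦ tensorialAt_koszul_left g hY hZ)
        (fun _ hX ↦ tensorialAt_koszul_right g hX hY))
  else 0

lemma inner_leviCivitaAux (hX : MDiffAt (T% X) p) (hY : MDiffAt (T% Y) p)
    (hZ : MDiffAt (T% Z) p) :
    g.inner p (leviCivitaAux g Y p (X p)) (Z p) = koszul g X Y Z p := by
  rw [leviCivitaAux, dif_pos hY]
  simp
  exact TensorialAt.mkHom₂_apply (Φ := fun X Z ↦ koszul g X Y Z p) _ _ hX hZ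

lemma exists_ext (v : TangentSpace I p) :
    ∃ X : Π x : M, TangentSpace I x, MDiffAt (T% X) p ∧ X p = v :=
  ⟨FiberBundle.extend E v, FiberBundle.mdifferentiableAt_extend .., by simp⟩

/-- The Levi-Civita connection of `g`. -/
def leviCivita : CovariantDerivative I E (TangentSpace I : M → Type _) where
  toFun := leviCivitaAux g
  isCovariantDerivativeOnUniv :=
    { add := by
        intro Y Y' p hY hY' _
        ext v
        apply ext_inner g p
        intro w
        obtain ⟨X, hX, rfl⟩ := exists_ext v
        obtain ⟨Z, hZ, rfl⟩ := exists_ext w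
        rw [inner_leviCivitaAux g hX (mdifferentiableAt_add_section hY hY') hZ, koszul_add g hX hY hY' hZ]
        simp [inner_leviCivitaAux g hX hY hZ, inner_leviCivitaAux g hX hY' hZ]
      leibniz := by
        intro Y f p hY hf _
        ext v
        apply ext_inner g p
        intro w
        obtain ⟨X, hX, rfl⟩ := exists_ext v
        obtain ⟨Z, hZ, rfl⟩ := exists_ext w
        rw [inner_leviCivitaAux g hX (hf.smul_section hY) hZ, koszul_smul g hf hX hY hZ]
        simp [inner_leviCivitaAux g hX hY hZ] }

lemma inner_leviCivita (hX : MDiffAt (T% X) p) (hY : MDiffAt (T% Y) p)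
    (hZ : MDiffAt (T% Z) p) :
    g.inner p (leviCivita g Y p (X p)) (Z p) = koszul g X Y Z p :=
  inner_leviCivitaAux g hX hY hZ

/-- The Levi-Civita connection is torsion free. -/
lemma leviCivita_torsion : (leviCivita g).torsion = 0 := by
  rw [CovariantDerivative.torsion_eq_zero_iff]
  intro X Y p hX hY
  apply ext_inner g p
  intro w
  obtain ⟨Z, hZ, rfl⟩ := exists_ext w
  rw [map_sub, sub_apply, inner_leviCivita g hX hY hZ, inner_leviCivita g hY hX hZ]
  simp only [koszul, pairing_comm g Y X, pairing_comm g Z X, pairing_comm g Z Y,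
    mlieBracket_swap_apply (V := Y) (W := X), mlieBracket_swap_apply (V := Z) (W := X),
    mlieBracket_swap_apply (V := Z) (W := Y)]
  simp
  ring

/-- The Levi-Civita connection is compatible with the metric. -/
lemma leviCivita_metric (hX : MDiffAt (T% X) p) (hY : MDiffAt (T% Y) p)
    (hZ : MDiffAt (T% Z) p) :
    mvfderiv I (pairing g Y Z) p (X p) =
      g.inner p (leviCivita g Y p (X p)) (Z p) + g.inner p (Y p) (leviCivita g Z p (X p)) := by
  rw [g.symm p (Y p), inner_leviCivita g hX hY hZ, inner_leviCivita g hX hZ hY]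
  simp only [koszul, pairing_comm g Y X, pairing_comm g Z X, pairing_comm g Z Y,
    mlieBracket_swap_apply (V := Y) (W := X), mlieBracket_swap_apply (V := Z) (W := X),
    mlieBracket_swap_apply (V := Z) (W := Y)]
  simp
  ring

/-- The gradient of `f`: the vector field with `g(grad f, w) = df(w)`. -/
def grad (f : M → ℝ) (p : M) : TangentSpace I p := (flat g p).symm (mvfderiv I f p)

/-- The Hessian `∇²f = ∇(grad f)` at `p`, as an endomorphism of `T_pM`. -/
def hess (f : M → ℝ) (p : M) : TangentSpace I p →L[ℝ] TangentSpace I p :=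
  leviCivita g (grad g f) p

/-- The Laplacian `Δf = tr ∇²f = div (grad f)`. -/
def laplacian (f : M → ℝ) (p : M) : ℝ := LinearMap.trace ℝ (TangentSpace I p) (hess g f p)

/-- An endomorphism `A` of `TM` is self-adjoint with respect to `g`. -/
def IsSelfAdjointFor (A : Π p : M, TangentSpace I p →L[ℝ] TangentSpace I p) : Prop :=
  ∀ (p : M) (v w : TangentSpace I p), g.inner p (A p v) w = g.inner p v (A p w)

/-- The Hessian of `f` is positive semidefinite: `g(∇²f(v), v) ≥ 0` for all `v`. (The Hessian of
a smooth function is always self-adjoint, because `∇` is torsion free and metric.) -/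
def HasPosSemidefHessian (f : M → ℝ) : Prop :=
  ∀ (p : M) (v : TangentSpace I p), 0 ≤ g.inner p (hess g f p v) v

/-- The Lie derivative `(𝓛_V g)(X, Y) = V(g(X, Y)) - g([V, X], Y) - g(X, [V, Y])`. -/
def lieDerivMetric (V X Y : Π x : M, TangentSpace I x) (p : M) : ℝ :=
  mvfderiv I (pairing g X Y) p (V p) - g.inner p (mlieBracket I V X p) (Y p)
    - g.inner p (X p) (mlieBracket I V Y p)

/-- The metric `g` is `V`-linear of slope `a`: `𝓛_V g = a g`. -/
def IsLinearMetric (V : Π x : M, TangentSpace I x) (a : ℝ) : Prop :=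
  ∀ (X Y : Π x : M, TangentSpace I x) (p : M), MDiffAt (T% X) p → MDiffAt (T% Y) p →
    lieDerivMetric g V X Y p = a * g.inner p (X p) (Y p)

/-- `U(M; V)`: the positive smooth functions `f` with `V f = f`, that is the positive smooth
functions that are `V`-linear of slope `1`. -/
structure IsPositiveLinear (V : Π x : M, TangentSpace I x) (f : M → ℝ) : Prop where
  smooth : ContMDiff I 𝓘(ℝ, ℝ) ∞ f
  linear : ∀ p, mvfderiv I f p (V p) = f p
  pos : ∀ p, 0 < f p

/-- The vector field `V` on the `d`-manifold `M` is cylindrical, with cross-section the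
codimension one submanifold `ι : Y → M`: it is transverse to `Y`, and its flow
defines a diffeomorphism `ℝ × Y ≃ M`. -/
structure IsCylindrical {d : ℕ} (m : ℕ)
    {M : Type*} [TopologicalSpace M] [ChartedSpace (EuclideanSpace ℝ (Fin d)) M]
    {Y : Type*} [TopologicalSpace Y] [ChartedSpace (EuclideanSpace ℝ (Fin m)) Y]
    (V : Π x : M, TangentSpace (𝓡 d) x) (ι : Y → M) : Prop where
  codim : m + 1 = d
  embedding : IsSmoothEmbedding (𝓡 m) (𝓡 d) ∞ ι
  transverse : ∀ y, (mfderiv (𝓡 m) (𝓡 d) ι y).range ⊔ Submodule.span ℝ {V (ι y)} = ⊤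
  flow : ∃ Φ : Diffeomorph (𝓘(ℝ, ℝ).prod (𝓡 m)) (𝓡 d) (ℝ × Y) M ∞,
    ∀ y, Φ (0, y) = ι y ∧ IsMIntegralCurve (fun t ↦ Φ (t, y)) V

section Volume

variable {d : ℕ} {M : Type*} [TopologicalSpace M] [ChartedSpace (EuclideanSpace ℝ (Fin d)) M]
  [IsManifold (𝓡 d) ∞ M] (g : SmoothMetric (𝓡 d) M)

/-- The matrix `g_ij = g(∂_i, ∂_j)` of `g` in the coordinates `φ` given by the preferred chart
at `x`, at the point with coordinates `y`. -/
def gramMatrix (x : M) (y : EuclideanSpace ℝ (Fin d)) : Matrix (Fin d) (Fin d) ℝ :=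
  Matrix.of fun i j ↦ g.inner ((extChartAt (𝓡 d) x).symm y)
    (mfderiv 𝓘(ℝ, EuclideanSpace ℝ (Fin d)) (𝓡 d) (extChartAt (𝓡 d) x).symm y
      (EuclideanSpace.single i 1))
    (mfderiv 𝓘(ℝ, EuclideanSpace ℝ (Fin d)) (𝓡 d) (extChartAt (𝓡 d) x).symm y
      (EuclideanSpace.single j 1))

/-- The measure `√(det g_ij) dy` on the domain of the preferred chart at `x`, extended by zero
to `M`. -/
def chartVolume [MeasurableSpace M] (x : M) : Measure M :=
  ((volume.restrict (extChartAt (𝓡 d) x).target).withDensity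
    fun y ↦ ENNReal.ofReal (Real.sqrt (gramMatrix g x y).det)).map (extChartAt (𝓡 d) x).symm

/-- The Riemannian volume measure `μ_g`: the least measure which dominates `√(det g_ij) dy` in
every chart. Since these local measures agree on overlaps, `μ_g` restricts to
`√(det g_ij) dy` on each chart domain. -/
def riemannianVolume [MeasurableSpace M] : Measure M := ⨆ x : M, chartVolume g x

/-- The Laplacian functional `S(f) = ∫_{f ≤ 1} Δf dμ_g`. -/
def laplacianFunctional [MeasurableSpace M] (f : M → ℝ) : ℝ :=
  ∫ p in {p | f p ≤ 1}, laplacian g f p ∂(riemannianVolume g)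

end Volume

end LaplacianFunctional

end

namespace LaplacianFunctional

open Bundle Manifold MeasureTheory VectorField

section CoordinateFields

lemma mlieBracket_eq_lieBracket {E : Type*} [NormedAddCommGroup E] [NormedSpace ℝ E]
    (V W : Π y : E, TangentSpace 𝓘(ℝ, E) y) :
    mlieBracket 𝓘(ℝ, E) V W = lieBracket ℝ V W := by
  rw [← mlieBracketWithin_univ, mlieBracketWithin_eq_lieBracketWithin]
  exact lieBracketWithin_univ

variable {E : Type*} [NormedAddCommGroup E] [NormedSpace ℝ E] [FiniteDimensional ℝ E]
  {H : Type*} [TopologicalSpace H] {I : ModelWithCorners ℝ E H} [I.Boundaryless]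
  {M : Type*} [TopologicalSpace M] [ChartedSpace H M] [IsManifold I ∞ M]
  {ι : Type*} [Fintype ι] (b : Module.Basis ι ℝ E) (x : M) {p : M}

variable (I) in
/-- The coordinate vector field `∂_i` of the preferred chart at `x`, in the basis `b`. -/
noncomputable def coordField (i : ι) : Π p : M, TangentSpace I p :=
  (trivializationAt E (TangentSpace I) x).localFrame b i

omit [I.Boundaryless] [Fintype ι] [FiniteDimensional ℝ E] in
lemma coordField_eq_symmL (i : ι) (hp : p ∈ (chartAt H x).source) :
    coordField I b x i p = (trivializationAt E (TangentSpace I) x).symmL ℝ p (b i) := by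
  have hp' : p ∈ (trivializationAt E (TangentSpace I) x).baseSet := by simpa using hp
  rw [coordField, Trivialization.localFrame_apply_of_mem_baseSet _ _ hp',
    Trivialization.basisAt, Module.Basis.map_apply]
  exact (Trivialization.symmL_apply _ hp' _).symm

lemma coordField_eq_mfderiv (i : ι) (hp : p ∈ (chartAt H x).source) :
    coordField I b x i p =
      mfderiv 𝓘(ℝ, E) I (extChartAt I x).symm (extChartAt I x p) (b i) := by
  have h := TangentBundle.symmL_trivializationAt (I := I) hp
  simp only [I.range_eq_univ, mfderivWithin_univ] at h
  rw [coordField_eq_symmL b x i hp, h]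
  rfl

lemma contMDiffAt_coordField (i : ι) (hp : p ∈ (chartAt H x).source) :
    ContMDiffAt I (I.prod 𝓘(ℝ, E)) ∞ (T% (coordField I b x i)) p := by
  have hp' : p ∈ (trivializationAt E (TangentSpace I) x).baseSet := by simpa using hp
  exact contMDiffAt_localFrame_of_mem (n := ∞) _ _ i hp'

lemma mdifferentiableAt_coordField (i : ι) (hp : p ∈ (chartAt H x).source) :
    MDiffAt (T% (coordField I b x i)) p :=
  (contMDiffAt_coordField b x i hp).mdifferentiableAt (by simp)

lemma coordField_eq_mpullback (i : ι) (hp : p ∈ (chartAt H x).source) :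
    coordField I b x i p = mpullback I 𝓘(ℝ, E) (extChartAt I x) (fun _ : E ↦ (b i : E)) p := by
  have hp1 : p ∈ (extChartAt I x).source := by simpa using hp
  rw [coordField_eq_mfderiv b x i hp]
  have h1 := mfderiv_extChartAt_comp_mfderivWithin_extChartAt_symm' (I := I) hp1
  have h2 := mfderivWithin_extChartAt_symm_comp_mfderiv_extChartAt' (I := I) hp1
  simp only [I.range_eq_univ, mfderivWithin_univ] at h1 h2
  exact (congrArg (fun L : E →L[ℝ] E ↦ L (b i)) (ContinuousLinearMap.inverse_eq h1 h2)).symm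

lemma mlieBracket_coordField (i j : ι) (hp : p ∈ (chartAt H x).source) :
    mlieBracket I (coordField I b x i) (coordField I b x j) p = 0 := by
  have key : ∀ i, coordField I b x i =ᶠ[nhds p]
      mpullback I 𝓘(ℝ, E) (extChartAt I x) (fun _ : E ↦ (b i : E)) := fun i ↦ by
    filter_upwards [(chartAt H x).open_source.mem_nhds hp] with q hq
    exact coordField_eq_mpullback b x i hq
  rw [(key i).mlieBracket_vectorField_eq (key j)]
  have hc : ∀ v : E, MDifferentiableAt 𝓘(ℝ, E) 𝓘(ℝ, E).tangent
      (fun y : E ↦ (⟨y, v⟩ : TangentBundle 𝓘(ℝ, E) E)) (extChartAt I x p) := fun v ↦ by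
    rw [mdifferentiableAt_totalSpace]
    exact ⟨mdifferentiableAt_id, by simpa using mdifferentiableAt_const⟩
  have : IsManifold I (minSmoothness ℝ 2) M := by
    rw [minSmoothness_of_isRCLikeNormedField]; infer_instance
  rw [← mpullback_mlieBracket (n := ∞) (hc (b i)) (hc (b j)) (contMDiffAt_extChartAt' hp)
    (by rw [minSmoothness_of_isRCLikeNormedField]; exact ENat.LEInfty.out)]
  have h0 : mlieBracket 𝓘(ℝ, E) (fun y : E ↦ (b i : TangentSpace 𝓘(ℝ, E) y))
      (fun y : E ↦ (b j : TangentSpace 𝓘(ℝ, E) y)) (extChartAt I x p) = 0 := by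
    refine (congrFun (mlieBracket_eq_lieBracket _ _) _).trans ?_
    change fderiv ℝ (fun _ : E ↦ b j) _ (b i) - fderiv ℝ (fun _ : E ↦ b i) _ (b j) = 0
    simp
  exact (congrArg _ h0).trans (map_zero _)

lemma mvfderiv_coordField {f : M → ℝ} (hf : MDiffAt f p) (i : ι) (hp : p ∈ (chartAt H x).source) :
    mvfderiv I f p (coordField I b x i p) =
      fderiv ℝ (f ∘ (extChartAt I x).symm) (extChartAt I x p) (b i) := by
  have hp1 : p ∈ (extChartAt I x).source := by simpa using hp
  have e1 : (extChartAt I x).symm (extChartAt I x p) = p := (extChartAt I x).left_inv hp1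
  have h2 : MDifferentiableAt 𝓘(ℝ, E) I (extChartAt I x).symm (extChartAt I x p) :=
    (contMDiffOn_extChartAt_symm (n := ∞) x).mdifferentiableOn (by simp) |>.mdifferentiableAt
      ((isOpen_extChartAt_target x).mem_nhds ((extChartAt I x).map_source hp1))
  rw [coordField_eq_mfderiv b x i hp]
  have h3 := mvfderiv_comp_apply_of_eq _ hf h2 e1 (b i)
  refine h3.symm.trans ?_
  rw [mvfderiv, mfderiv_eq_fderiv]
  rfl

/-- The basis of `T_pM` formed by the coordinate vector fields. -/
noncomputable def coordBasis (hp : p ∈ (chartAt H x).source) :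
    Module.Basis ι ℝ (TangentSpace I p) :=
  (trivializationAt E (TangentSpace I) x).basisAt b (by simpa using hp)

@[simp] lemma coordBasis_apply (hp : p ∈ (chartAt H x).source) (i : ι) :
    coordBasis b x hp i = coordField I b x i p :=
  (Trivialization.localFrame_apply_of_mem_baseSet _ _ (by simpa using hp)).symm

variable (I) in
/-- The coordinates of a vector field with respect to the coordinate vector fields. -/
noncomputable def coordComp (X : Π p : M, TangentSpace I p) (i : ι) (p : M) : ℝ :=
  (trivializationAt E (TangentSpace I) x).localFrameCoeff I b i p (X p)

lemma eq_sum_coordComp (X : Π p : M, TangentSpace I p) (hp : p ∈ (chartAt H x).source) :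
    X p = ∑ i, coordComp I b x X i p • coordField I b x i p :=
  Trivialization.eq_sum_localFrameCoeff_smul (s := X) (by simpa using hp)

lemma coordComp_eq_repr (X : Π p : M, TangentSpace I p) (i : ι) (hp : p ∈ (chartAt H x).source) :
    coordComp I b x X i p = (coordBasis b x hp).repr (X p) i :=
  Trivialization.localFrameCoeff_apply_of_mem_baseSet _ b (by simpa using hp) X i

lemma contMDiffAt_coordComp {X : Π p : M, TangentSpace I p} {n : ℕ∞}
    (hX : ContMDiffAt I (I.prod 𝓘(ℝ, E)) n (T% X) p) (i : ι) (hp : p ∈ (chartAt H x).source) :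
    ContMDiffAt I 𝓘(ℝ) n (coordComp I b x X i) p :=
  contMDiffAt_localFrameCoeff b (by simpa using hp) hX i

lemma contMDiffAt_of_coordComp {X : Π p : M, TangentSpace I p} {n : ℕ∞}
    (hp : p ∈ (chartAt H x).source)
    (hX : ∀ i, ContMDiffAt I 𝓘(ℝ) n (coordComp I b x X i) p) :
    ContMDiffAt I (I.prod 𝓘(ℝ, E)) n (T% X) p :=
  (contMDiffAt_iff_localFrameCoeff (e := trivializationAt E (TangentSpace I) x) b
    (by simpa using hp)).2 hX

end CoordinateFields

section LinearAlgebra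

variable {ι : Type*} [Fintype ι] [DecidableEq ι]

lemma det_updateRow_eq_sum_adjugate (A : Matrix ι ι ℝ) (i : ι) (r : ι → ℝ) :
    (A.updateRow i r).det = ∑ j, A.adjugate j i * r j := by
  rw [← Matrix.cramer_transpose_apply, Matrix.cramer_eq_adjugate_mulVec, Matrix.mulVec,
    ← Matrix.adjugate_transpose]
  rfl

/-- Jacobi's formula for the derivative of a determinant. -/
lemma hasFDerivAt_det {E : Type*} [NormedAddCommGroup E] [NormedSpace ℝ E]
    {A : E → Matrix ι ι ℝ} {A' : ι → ι → E →L[ℝ] ℝ} {y : E}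
    (hA : ∀ i j, HasFDerivAt (fun z ↦ A z i j) (A' i j) y) :
    HasFDerivAt (fun z ↦ (A z).det) (∑ i, ∑ j, (A y).adjugate j i • A' i j) y := by
  let D : ContinuousMultilinearMap ℝ (fun _ : ι ↦ ι → ℝ) ℝ :=
    { (Matrix.detRowAlternating (n := ι) (R := ℝ)).toMultilinearMap with
      cont := Continuous.matrix_det continuous_id }
  have hA1 : HasFDerivAt (fun z i j ↦ A z i j)
      (ContinuousLinearMap.pi fun i ↦ ContinuousLinearMap.pi fun j ↦ A' i j) y :=
    hasFDerivAt_pi.2 fun i ↦ hasFDerivAt_pi.2 fun j ↦ hA i j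
  have h := (D.hasFDerivAt (fun i j ↦ A y i j)).comp y hA1
  convert! h using 1
  ext v
  simp only [ContinuousLinearMap.comp_apply, ContinuousMultilinearMap.linearDeriv_apply,
    sum_apply, smul_apply, smul_eq_mul]
  refine Finset.sum_congr rfl fun i _ ↦ ?_
  exact (det_updateRow_eq_sum_adjugate (A y) i fun j ↦ A' i j v).symm

lemma hasFDerivAt_sqrt_det {E : Type*} [NormedAddCommGroup E] [NormedSpace ℝ E]
    {A : E → Matrix ι ι ℝ} {A' : ι → ι → E →L[ℝ] ℝ} {y : E}
    (hA : ∀ i j, HasFDerivAt (fun z ↦ A z i j) (A' i j) y) (hpos : 0 < (A y).det) :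
    HasFDerivAt (fun z ↦ √(A z).det)
      ((√(A y).det / 2) • ∑ i, ∑ j, (A y)⁻¹ j i • A' i j) y := by
  convert! (hasFDerivAt_det hA).sqrt hpos.ne' using 1
  ext v
  simp only [sum_apply, smul_apply, smul_eq_mul,
    Matrix.inv_def, Matrix.smul_apply, Ring.inverse_eq_inv', Finset.mul_sum]
  refine Finset.sum_congr rfl fun i _ ↦ Finset.sum_congr rfl fun j _ ↦ ?_
  have h1 : √(A y).det ≠ 0 := (Real.sqrt_pos.2 hpos).ne'
  have h2 := Real.sq_sqrt hpos.le
  field_simp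
  rw [h2]

end LinearAlgebra

section Gram

variable {E : Type*} [NormedAddCommGroup E] [NormedSpace ℝ E] [FiniteDimensional ℝ E]
  {H : Type*} [TopologicalSpace H] {I : ModelWithCorners ℝ E H} [I.Boundaryless]
  {M : Type*} [TopologicalSpace M] [ChartedSpace H M] [IsManifold I ∞ M]
  {ι : Type*} [Fintype ι] [DecidableEq ι] (g : SmoothMetric I M) (b : Module.Basis ι ℝ E)
  (x : M) {p : M}

/-- The matrix `g(∂_i, ∂_j)` as a function on the manifold. -/
noncomputable def coordGram (p : M) : Matrix ι ι ℝ :=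
  Matrix.of fun i j ↦ pairing g (coordField I b x i) (coordField I b x j) p

lemma contMDiffAt_pairing {n : ℕ∞} {X Y : Π p : M, TangentSpace I p}
    (hX : ContMDiffAt I (I.prod 𝓘(ℝ, E)) n (T% X) p)
    (hY : ContMDiffAt I (I.prod 𝓘(ℝ, E)) n (T% Y) p) :
    ContMDiffAt I 𝓘(ℝ) n (pairing g X Y) p := by
  have h1 := (g.contMDiff p).of_le (m := n) (by exact_mod_cast le_top)
  have : ContMDiffAt I (I.prod 𝓘(ℝ)) n
      (fun m ↦ TotalSpace.mk' ℝ (E := Bundle.Trivial M ℝ) m (g.inner m (X m) (Y m))) p := by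
    apply ContMDiffAt.clm_bundle_apply₂ (F₁ := E) (F₂ := E)
    · exact h1
    · exact hX
    · exact hY
  simp only [contMDiffAt_totalSpace] at this
  exact this.2

lemma contMDiffAt_coordGram (i j : ι) (hp : p ∈ (chartAt H x).source) :
    ContMDiffAt I 𝓘(ℝ) ∞ (fun q ↦ coordGram g b x q i j) p :=
  contMDiffAt_pairing g (contMDiffAt_coordField b x i hp) (contMDiffAt_coordField b x j hp)

lemma coordGram_isSymm : (coordGram g b x p).IsSymm := by
  ext i j
  exact g.symm p _ _

lemma coordGram_posDef (hp : p ∈ (chartAt H x).source) : (coordGram g b x p).PosDef := by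
  refine Matrix.PosDef.of_dotProduct_mulVec_pos ?_ ?_
  · rw [Matrix.IsHermitian, Matrix.conjTranspose_eq_transpose_of_trivial]
    exact coordGram_isSymm g b x
  · intro c hc
    have h1 : ∑ i, c i • coordField I b x i p ≠ 0 := by
      intro h
      apply hc
      have h2 := (coordBasis (I := I) b x hp).linearIndependent
      rw [Fintype.linearIndependent_iff] at h2
      funext i
      exact h2 c (by simpa using h) i
    have h2 := g.pos p _ h1
    convert! h2 using 1
    simp [Matrix.mulVec, dotProduct, coordGram, pairing, Finset.mul_sum, mul_comm]
    exact Finset.sum_comm.trans (by simp only [mul_left_comm])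

lemma coordGram_det_pos (hp : p ∈ (chartAt H x).source) : 0 < (coordGram g b x p).det :=
  (coordGram_posDef g b x hp).det_pos

/-- Coordinates of a vector in terms of the metric. -/
lemma coordBasis_repr_eq (hp : p ∈ (chartAt H x).source) (v : TangentSpace I p) (i : ι) :
    (coordBasis b x hp).repr v i =
      ∑ k, (coordGram g b x p)⁻¹ i k * g.inner p v (coordField I b x k p) := by
  set c := (coordBasis b x hp).repr v
  have h1 : (fun k ↦ g.inner p v (coordField I b x k p)) = (coordGram g b x p).mulVec c := by
    funext k
    conv_lhs => rw [← (coordBasis b x hp).sum_repr v]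
    simp only [coordBasis_apply, map_sum, map_smul, Matrix.mulVec, dotProduct, coordGram, pairing,
      sum_apply, smul_apply, smul_eq_mul, Matrix.of_apply]
    refine Finset.sum_congr rfl fun j _ ↦ ?_
    rw [g.symm p (coordField I b x k p), mul_comm]
  have h2 : (coordGram g b x p)⁻¹.mulVec ((coordGram g b x p).mulVec c) = c := by
    rw [Matrix.mulVec_mulVec, Matrix.nonsing_inv_mul _ (coordGram_det_pos g b x hp).ne'.isUnit,
      Matrix.one_mulVec]
  rw [← h1] at h2
  exact (congrFun h2 i).symm

lemma trace_eq_sum_gram (hp : p ∈ (chartAt H x).source)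
    (A : TangentSpace I p →L[ℝ] TangentSpace I p) :
    LinearMap.trace ℝ (TangentSpace I p) A = ∑ i, ∑ k, (coordGram g b x p)⁻¹ i k *
      g.inner p (A (coordField I b x i p)) (coordField I b x k p) := by
  rw [LinearMap.trace_eq_matrix_trace ℝ (coordBasis b x hp), Matrix.trace]
  refine Finset.sum_congr rfl fun i _ ↦ ?_
  rw [← coordBasis_repr_eq g b x hp, Matrix.diag_apply, LinearMap.toMatrix_apply]
  simp

end Gram

section Divergence

variable {E : Type*} [NormedAddCommGroup E] [NormedSpace ℝ E] [FiniteDimensional ℝ E]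
  {H : Type*} [TopologicalSpace H] {I : ModelWithCorners ℝ E H}
  {M : Type*} [TopologicalSpace M] [ChartedSpace H M] [IsManifold I ∞ M]
  (g : SmoothMetric I M) {X Y : Π p : M, TangentSpace I p} {f : M → ℝ} {p : M}

/-- The divergence `tr ∇X` of a vector field. -/
noncomputable def divergence (X : Π p : M, TangentSpace I p) (p : M) : ℝ :=
  LinearMap.trace ℝ (TangentSpace I p) (leviCivita g X p)

lemma laplacian_eq_divergence (f : M → ℝ) : laplacian g f = divergence g (grad g f) := rfl

lemma leviCivita_add (hX : MDiffAt (T% X) p) (hY : MDiffAt (T% Y) p) :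
    leviCivita g (X + Y) p = leviCivita g X p + leviCivita g Y p :=
  (leviCivita g).isCovariantDerivativeOnUniv.add hX hY

lemma leviCivita_smul (hX : MDiffAt (T% X) p) (hf : MDiffAt f p) :
    leviCivita g (f • X) p = f p • leviCivita g X p + (mvfderiv I f p).smulRight (X p) :=
  (leviCivita g).isCovariantDerivativeOnUniv.leibniz hX hf

lemma leviCivita_sum {ι : Type*} (s : Finset ι) {X : ι → Π p : M, TangentSpace I p}
    (hX : ∀ i ∈ s, MDiffAt (T% (X i)) p) :
    leviCivita g (∑ i ∈ s, X i) p = ∑ i ∈ s, leviCivita g (X i) p := by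
  classical
  have key : MDiffAt (T% (∑ i ∈ s, X i)) p ∧
      leviCivita g (∑ i ∈ s, X i) p = ∑ i ∈ s, leviCivita g (X i) p := by
    induction s using Finset.induction_on with
    | empty =>
      simp only [Finset.sum_empty]
      exact ⟨mdifferentiableAt_zeroSection .., by rw [(leviCivita g).zero]; rfl⟩
    | insert i s hi ih =>
      obtain ⟨h1, h2⟩ := ih fun j hj ↦ hX j (Finset.mem_insert_of_mem hj)
      have h3 := hX i (Finset.mem_insert_self i s)
      rw [Finset.sum_insert hi, Finset.sum_insert hi, ← h2]
      exact ⟨mdifferentiableAt_add_section h3 h1, leviCivita_add g h3 h1⟩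
  exact key.2

lemma leviCivita_congr (hX : MDiffAt (T% X) p) (hY : MDiffAt (T% Y) p)
    (h : ∀ᶠ q in nhds p, X q = Y q) : leviCivita g X p = leviCivita g Y p :=
  (leviCivita g).isCovariantDerivativeOnUniv.congr_of_eventuallyEq hX hY Filter.univ_mem h

lemma trace_smulRight (φ : TangentSpace I p →L[ℝ] ℝ) (v : TangentSpace I p) :
    LinearMap.trace ℝ (TangentSpace I p) (φ.smulRight v : TangentSpace I p →L[ℝ] TangentSpace I p)
      = φ v := by
  have : FiniteDimensional ℝ (TangentSpace I p) := inferInstanceAs (FiniteDimensional ℝ E)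
  exact LinearMap.trace_smulRight φ.toLinearMap v

lemma divergence_smul (hX : MDiffAt (T% X) p) (hf : MDiffAt f p) :
    divergence g (f • X) p = f p * divergence g X p + mvfderiv I f p (X p) := by
  rw [divergence, leviCivita_smul g hX hf, ContinuousLinearMap.toLinearMap_add, map_add,
    trace_smulRight, ContinuousLinearMap.toLinearMap_smul, map_smul]
  rfl

lemma divergence_sum {ι : Type*} (s : Finset ι) {X : ι → Π p : M, TangentSpace I p}
    (hX : ∀ i ∈ s, MDiffAt (T% (X i)) p) :
    divergence g (∑ i ∈ s, X i) p = ∑ i ∈ s, divergence g (X i) p := by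
  rw [divergence, leviCivita_sum g s hX, ContinuousLinearMap.toLinearMap_sum, map_sum]
  rfl

lemma divergence_congr (hX : MDiffAt (T% X) p) (hY : MDiffAt (T% Y) p)
    (h : ∀ᶠ q in nhds p, X q = Y q) : divergence g X p = divergence g Y p := by
  rw [divergence, leviCivita_congr g hX hY h, divergence]

variable [I.Boundaryless] {ι : Type*} [Fintype ι] [DecidableEq ι] (b : Module.Basis ι ℝ E) (x : M)

lemma divergence_coordField (j : ι) (hp : p ∈ (chartAt H x).source) :
    divergence g (coordField I b x j) p = (∑ i, ∑ k, (coordGram g b x p)⁻¹ k i *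
      mvfderiv I (fun q ↦ coordGram g b x q i k) p (coordField I b x j p)) / 2 := by
  have hm : ∀ i, MDiffAt (T% (coordField I b x i)) p :=
    fun i ↦ mdifferentiableAt_coordField b x i hp
  have hk : ∀ i k, g.inner p (leviCivita g (coordField I b x j) p (coordField I b x i p))
      (coordField I b x k p) =
      (mvfderiv I (pairing g (coordField I b x j) (coordField I b x k)) p (coordField I b x i p)
      + mvfderiv I (pairing g (coordField I b x k) (coordField I b x i)) p (coordField I b x j p)
      - mvfderiv I (pairing g (coordField I b x i) (coordField I b x j)) p
        (coordField I b x k p)) / 2 := fun i k ↦ by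
    rw [inner_leviCivita g (hm i) (hm j) (hm k), koszul]
    simp [mlieBracket_coordField b x _ _ hp]
  have hsym : ∀ i k, (coordGram g b x p)⁻¹ i k = (coordGram g b x p)⁻¹ k i := fun i k ↦
    ((coordGram_isSymm g b x (p := p)).inv.apply i k).symm
  rw [divergence, trace_eq_sum_gram g b x hp]
  simp only [hk]
  have hsw : ∑ i, ∑ k, (coordGram g b x p)⁻¹ i k *
      mvfderiv I (pairing g (coordField I b x i) (coordField I b x j)) p (coordField I b x k p)
      = ∑ i, ∑ k, (coordGram g b x p)⁻¹ i k *
      mvfderiv I (pairing g (coordField I b x j) (coordField I b x k)) p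
        (coordField I b x i p) := by
    rw [Finset.sum_comm]
    refine Finset.sum_congr rfl fun i _ ↦ Finset.sum_congr rfl fun k _ ↦ ?_
    rw [hsym, pairing_comm]
  have h3 : ∑ i, ∑ k, (coordGram g b x p)⁻¹ i k * mvfderiv I (pairing g (coordField I b x k)
      (coordField I b x i)) p (coordField I b x j p) = ∑ i, ∑ k, (coordGram g b x p)⁻¹ k i *
      mvfderiv I (fun q ↦ coordGram g b x q i k) p (coordField I b x j p) := by
    refine Finset.sum_congr rfl fun i _ ↦ Finset.sum_congr rfl fun k _ ↦ ?_
    rw [hsym, pairing_comm]; rfl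
  rw [← h3, eq_div_iff two_ne_zero, Finset.sum_mul]
  calc _ = ∑ i, ∑ k, ((coordGram g b x p)⁻¹ i k * mvfderiv I (pairing g (coordField I b x j)
      (coordField I b x k)) p (coordField I b x i p) + (coordGram g b x p)⁻¹ i k *
      mvfderiv I (pairing g (coordField I b x k) (coordField I b x i)) p (coordField I b x j p) -
      (coordGram g b x p)⁻¹ i k * mvfderiv I (pairing g (coordField I b x i)
      (coordField I b x j)) p (coordField I b x k p)) := by
        refine Finset.sum_congr rfl fun i _ ↦ ?_
        rw [Finset.sum_mul]
        refine Finset.sum_congr rfl fun k _ ↦ ?_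
        ring
    _ = _ := by
        simp only [Finset.sum_add_distrib, Finset.sum_sub_distrib, hsw]
        ring

lemma divergence_eq_sum_coord (hX : MDiffAt (T% X) p) (hp : p ∈ (chartAt H x).source) :
    divergence g X p = ∑ j, (coordComp I b x X j p * divergence g (coordField I b x j) p +
      mvfderiv I (coordComp I b x X j) p (coordField I b x j p)) := by
  have hm : ∀ i, MDiffAt (T% (coordField I b x i)) p :=
    fun i ↦ mdifferentiableAt_coordField b x i hp
  have hc : ∀ i, MDiffAt (coordComp I b x X i) p := fun i ↦
    mdifferentiableAt_localFrameCoeff b (by simpa using hp) hX i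
  have hs : ∀ i ∈ Finset.univ, MDiffAt (T% (coordComp I b x X i • coordField I b x i)) p :=
    fun i _ ↦ (hc i).smul_section (hm i)
  have hev : ∀ᶠ q in nhds p, (∑ i, coordComp I b x X i • coordField I b x i) q = X q := by
    filter_upwards [(chartAt H x).open_source.mem_nhds hp] with q hq
    simpa using (eq_sum_coordComp b x X hq).symm
  have hsum : MDiffAt (T% (∑ i, coordComp I b x X i • coordField I b x i)) p := by
    refine hX.congr_of_eventuallyEq ?_
    filter_upwards [hev] with q hq
    rw [hq]
  rw [← divergence_congr g hsum hX hev, divergence_sum g _ hs]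
  exact Finset.sum_congr rfl fun i _ ↦ divergence_smul g (hm i) (hc i)

end Divergence

section Chart

variable {E : Type*} [NormedAddCommGroup E] [NormedSpace ℝ E] [FiniteDimensional ℝ E]
  {H : Type*} [TopologicalSpace H] {I : ModelWithCorners ℝ E H} [I.Boundaryless]
  {M : Type*} [TopologicalSpace M] [ChartedSpace H M] [IsManifold I ∞ M]
  {ι : Type*} [Fintype ι] [DecidableEq ι] (g : SmoothMetric I M) (b : Module.Basis ι ℝ E)
  (x : M) {p : M} {y : E}

lemma contMDiffAt_extChartAt_symm {n : ℕ∞} (hy : y ∈ (extChartAt I x).target) :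
    ContMDiffAt 𝓘(ℝ, E) I n (extChartAt I x).symm y :=
  ((contMDiffOn_extChartAt_symm (n := ∞) x).of_le (by exact_mod_cast le_top)).contMDiffAt
    ((isOpen_extChartAt_target x).mem_nhds hy)

lemma contDiffAt_comp_extChartAt_symm {n : ℕ∞} {f : M → ℝ} (hy : y ∈ (extChartAt I x).target)
    (hf : ContMDiffAt I 𝓘(ℝ) n f ((extChartAt I x).symm y)) :
    ContDiffAt ℝ n (f ∘ (extChartAt I x).symm) y :=
  (hf.comp y (contMDiffAt_extChartAt_symm x hy)).contDiffAt

lemma differentiableAt_comp_extChartAt_symm {f : M → ℝ} (hy : y ∈ (extChartAt I x).target)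
    (hf : MDiffAt f ((extChartAt I x).symm y)) :
    DifferentiableAt ℝ (f ∘ (extChartAt I x).symm) y :=
  (hf.comp y ((contMDiffAt_extChartAt_symm (n := 1) x hy).mdifferentiableAt
    (by simp))).differentiableAt

omit [I.Boundaryless] in
lemma extChartAt_symm_mem_source (hy : y ∈ (extChartAt I x).target) :
    (extChartAt I x).symm y ∈ (chartAt H x).source := by
  simpa using (extChartAt I x).map_target hy

variable {g} in
lemma mdifferentiableAt_coordComp {X : Π p : M, TangentSpace I p} (hX : MDiffAt (T% X) p) (j : ι)
    (hp : p ∈ (chartAt H x).source) : MDiffAt (coordComp I b x X j) p :=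
  mdifferentiableAt_localFrameCoeff b (by simpa using hp) hX j

/-- The Riemannian density `√(det g_ij)` in the coordinates of the chart at `x`. -/
noncomputable def coordDensity (y : E) : ℝ := √(coordGram g b x ((extChartAt I x).symm y)).det

/-- The divergence in local coordinates. -/
lemma coordDensity_mul_divergence {X : Π p : M, TangentSpace I p}
    (hy : y ∈ (extChartAt I x).target) (hX : MDiffAt (T% X) ((extChartAt I x).symm y)) :
    coordDensity g b x y * divergence g X ((extChartAt I x).symm y) =
      ∑ j, fderiv ℝ (fun z ↦ coordDensity g b x z *
        coordComp I b x X j ((extChartAt I x).symm z)) y (b j) := by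
  set p := (extChartAt I x).symm y with hpdef
  have hp : p ∈ (chartAt H x).source := extChartAt_symm_mem_source x hy
  have hyp : extChartAt I x p = y := (extChartAt I x).right_inv hy
  have hG : ∀ i k, HasFDerivAt (fun z ↦ coordGram g b x ((extChartAt I x).symm z) i k)
      (fderiv ℝ ((fun q ↦ coordGram g b x q i k) ∘ (extChartAt I x).symm) y) y := fun i k ↦
    (differentiableAt_comp_extChartAt_symm x hy
      ((contMDiffAt_coordGram g b x i k hp).mdifferentiableAt (by simp))).hasFDerivAt
  have hD := hasFDerivAt_sqrt_det hG (coordGram_det_pos g b x hp)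
  have hc : ∀ j, HasFDerivAt (fun z ↦ coordComp I b x X j ((extChartAt I x).symm z))
      (fderiv ℝ (coordComp I b x X j ∘ (extChartAt I x).symm) y) y := fun j ↦
    (differentiableAt_comp_extChartAt_symm x hy
      (mdifferentiableAt_coordComp b x hX j hp)).hasFDerivAt
  rw [divergence_eq_sum_coord g b x hX hp, Finset.mul_sum]
  refine Finset.sum_congr rfl fun j _ ↦ ?_
  have hfd : fderiv ℝ (fun z ↦ coordDensity g b x z *
      coordComp I b x X j ((extChartAt I x).symm z)) y = _ := (hD.mul (hc j)).fderiv
  rw [hfd, divergence_coordField g b x j hp,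
    mvfderiv_coordField b x (mdifferentiableAt_coordComp b x hX j hp) j hp, hyp]
  have h1 : ∀ i k, mvfderiv I (fun q ↦ coordGram g b x q i k) p (coordField I b x j p) =
      fderiv ℝ ((fun q ↦ coordGram g b x q i k) ∘ (extChartAt I x).symm) y (b j) := fun i k ↦ by
    rw [mvfderiv_coordField b x ((contMDiffAt_coordGram g b x i k hp).mdifferentiableAt (by simp))
      j hp, hyp]
  simp only [h1, add_apply, smul_apply, sum_apply, smul_eq_mul, coordDensity]
  rw [← hpdef]
  ring

lemma contMDiffAt_mvfderiv_coordField {f : M → ℝ} (hf : ContMDiff I 𝓘(ℝ) ∞ f) (i : ι)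
    (hp : p ∈ (chartAt H x).source) :
    ContMDiffAt I 𝓘(ℝ) ∞ (fun q ↦ mvfderiv I f q (coordField I b x i q)) p := by
  have hp1 : p ∈ (extChartAt I x).source := by simpa using hp
  have h1 : ContDiffAt ℝ ∞ (fun z ↦ fderiv ℝ (f ∘ (extChartAt I x).symm) z (b i))
      (extChartAt I x p) :=
    ((contDiffAt_comp_extChartAt_symm (n := ⊤) x ((extChartAt I x).map_source hp1)
      (hf _)).fderiv_right (m := ∞) (by simp)).clm_apply contDiffAt_const
  have h2 := h1.contMDiffAt.comp p (contMDiffAt_extChartAt' (n := ∞) hp)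
  refine h2.congr_of_eventuallyEq ?_
  filter_upwards [(chartAt H x).open_source.mem_nhds hp] with q hq
  exact mvfderiv_coordField b x (hf.mdifferentiableAt (by simp)) i hq

lemma contMDiffAt_det {A : M → Matrix ι ι ℝ}
    (hA : ∀ i j, ContMDiffAt I 𝓘(ℝ) ∞ (fun q ↦ A q i j) p) :
    ContMDiffAt I 𝓘(ℝ) ∞ (fun q ↦ (A q).det) p := by
  simp only [Matrix.det_apply', ]
  refine ContMDiffAt.sum fun σ _ ↦ ?_
  exact contMDiffAt_const.mul (ContMDiffAt.prod fun i _ ↦ hA _ _)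

lemma contMDiffAt_inv {A : M → Matrix ι ι ℝ}
    (hA : ∀ i j, ContMDiffAt I 𝓘(ℝ) ∞ (fun q ↦ A q i j) p) (hdet : (A p).det ≠ 0) (i j : ι) :
    ContMDiffAt I 𝓘(ℝ) ∞ (fun q ↦ (A q)⁻¹ i j) p := by
  have h1 : ContMDiffAt I 𝓘(ℝ) ∞ (fun q ↦ (A q).det⁻¹) p :=
    ((contDiffAt_inv ℝ hdet).contMDiffAt (n := ∞)).comp p (contMDiffAt_det hA)
  have h2 : ContMDiffAt I 𝓘(ℝ) ∞ (fun q ↦ (A q).adjugate i j) p := by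
    simp only [Matrix.adjugate_apply]
    refine contMDiffAt_det fun k l ↦ ?_
    by_cases hk : k = j
    · subst hk
      simpa [Matrix.updateRow_self] using contMDiffAt_const
    · simpa [Matrix.updateRow_ne hk] using hA k l
  simpa [Matrix.inv_def, Pi.mul_def] using h1.mul h2

lemma inner_grad (f : M → ℝ) (v : TangentSpace I p) :
    g.inner p (grad g f p) v = mvfderiv I f p v := inner_flat_symm g p _ v

/-- The gradient of a smooth function is smooth. -/
lemma contMDiff_grad {f : M → ℝ} (hf : ContMDiff I 𝓘(ℝ) ∞ f) :
    ContMDiff I (I.prod 𝓘(ℝ, E)) ∞ (T% (grad g f)) := by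
  intro p
  have hp : p ∈ (chartAt H p).source := mem_chart_source H p
  let b := Module.finBasis ℝ E
  refine contMDiffAt_of_coordComp (n := ⊤) b p hp fun i ↦ ?_
  have h1 : ContMDiffAt I 𝓘(ℝ) ∞ (fun q ↦ ∑ k, (coordGram g b p q)⁻¹ i k *
      mvfderiv I f q (coordField I b p k q)) p :=
    ContMDiffAt.sum fun k _ ↦ (contMDiffAt_inv (fun i j ↦ contMDiffAt_coordGram g b p i j hp)
      (coordGram_det_pos g b p hp).ne' i k).mul (contMDiffAt_mvfderiv_coordField b p hf k hp)
  refine h1.congr_of_eventuallyEq ?_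
  filter_upwards [(chartAt H p).open_source.mem_nhds hp] with q hq
  rw [coordComp_eq_repr b p _ i hq, coordBasis_repr_eq g b p hq]
  simp only [inner_grad]

lemma mdifferentiableAt_grad {f : M → ℝ} (hf : ContMDiff I 𝓘(ℝ) ∞ f) :
    MDiffAt (T% (grad g f)) p :=
  (contMDiff_grad g hf).mdifferentiableAt (by simp)

/-- The Hessian of a smooth function is self-adjoint. -/
lemma hess_symm {f : M → ℝ} (hf : ContMDiff I 𝓘(ℝ) ∞ f) (v w : TangentSpace I p) :
    g.inner p (hess g f p v) w = g.inner p v (hess g f p w) := by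
  have hp : p ∈ (chartAt H p).source := mem_chart_source H p
  have hp1 : p ∈ (extChartAt I p).source := by simp
  have hpt := (extChartAt I p).map_source hp1
  let b := Module.finBasis ℝ E
  have hm : ∀ i, MDiffAt (T% (coordField I b p i)) p :=
    fun i ↦ mdifferentiableAt_coordField b p i hp
  set F := f ∘ (extChartAt I p).symm with hF
  have hFs : ContDiffAt ℝ ∞ F (extChartAt I p p) :=
    contDiffAt_comp_extChartAt_symm (n := ⊤) p hpt (hf _)
  have hFd : DifferentiableAt ℝ (fderiv ℝ F) (extChartAt I p p) :=
    (hFs.fderiv_right (m := 1) (by rw [one_add_one_eq_two]; exact ENat.LEInfty.out)).differentiableAt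
      (by simp)
  have h2 : ∀ i j, mvfderiv I (pairing g (grad g f) (coordField I b p j)) p
      (coordField I b p i p) = fderiv ℝ (fderiv ℝ F) (extChartAt I p p) (b i) (b j) := fun i j ↦ by
    rw [mvfderiv_coordField b p (mdifferentiableAt_pairing g (mdifferentiableAt_grad g hf) (hm j))
      i hp]
    have he : pairing g (grad g f) (coordField I b p j) ∘ (extChartAt I p).symm
        =ᶠ[nhds (extChartAt I p p)] fun z ↦ fderiv ℝ F z (b j) := by
      filter_upwards [(isOpen_extChartAt_target p).mem_nhds hpt] with z hz
      have := mvfderiv_coordField b p (hf.mdifferentiableAt (by simp)) j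
        (extChartAt_symm_mem_source p hz)
      rw [(extChartAt I p).right_inv hz] at this
      rw [← this, Function.comp_apply, pairing, inner_grad]
    rw [he.fderiv_eq, fderiv_clm_apply hFd (differentiableAt_const _)]
    simp
  have htor : ∀ i j, leviCivita g (coordField I b p j) p (coordField I b p i p) =
      leviCivita g (coordField I b p i) p (coordField I b p j p) := fun i j ↦ by
    have h := (leviCivita g).torsion_apply (hm i) (hm j)
    rw [leviCivita_torsion, mlieBracket_coordField b p i j hp, sub_zero] at h
    exact (sub_eq_zero.1 (h.symm.trans (by simp)))
  have key : ∀ i j, g.inner p (hess g f p (coordField I b p i p)) (coordField I b p j p) =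
      g.inner p (hess g f p (coordField I b p j p)) (coordField I b p i p) := fun i j ↦ by
    have h3 := leviCivita_metric g (hm i) (mdifferentiableAt_grad g hf) (hm j)
    have h4 := leviCivita_metric g (hm j) (mdifferentiableAt_grad g hf) (hm i)
    have hsymm := (hFs.isSymmSndFDerivAt (by
      rw [minSmoothness_of_isRCLikeNormedField]; exact ENat.LEInfty.out)) (b i) (b j)
    rw [h2] at h3 h4
    rw [htor] at h3
    rw [hsymm] at h3
    unfold hess
    linarith
  rw [g.symm p v]
  have hv := (coordBasis b p hp).sum_repr v
  have hw := (coordBasis b p hp).sum_repr w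
  rw [← hv, ← hw]
  simp only [map_sum, map_smul, sum_apply, smul_apply, coordBasis_apply, smul_eq_mul,
    Finset.mul_sum]
  rw [Finset.sum_comm]
  refine Finset.sum_congr rfl fun i _ ↦ Finset.sum_congr rfl fun j _ ↦ ?_
  rw [key]; ring

end Chart

section VolumeCharts

variable {d : ℕ} {M : Type*} [TopologicalSpace M] [ChartedSpace (EuclideanSpace ℝ (Fin d)) M]
  [IsManifold (𝓡 d) ∞ M] (g : SmoothMetric (𝓡 d) M) (x x' : M)

/-- The standard basis of Euclidean space. -/
noncomputable abbrev stdBasis (d : ℕ) : Module.Basis (Fin d) ℝ (EuclideanSpace ℝ (Fin d)) :=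
  (EuclideanSpace.basisFun (Fin d) ℝ).toBasis

lemma stdBasis_apply (i : Fin d) : stdBasis d i = EuclideanSpace.single i 1 := by
  simp [stdBasis]

lemma gramMatrix_eq_coordGram {y : EuclideanSpace ℝ (Fin d)}
    (hy : y ∈ (extChartAt (𝓡 d) x).target) :
    gramMatrix g x y = coordGram g (stdBasis d) x ((extChartAt (𝓡 d) x).symm y) := by
  ext i j
  have hp := extChartAt_symm_mem_source (I := 𝓡 d) x hy
  have h : ∀ i : Fin d, coordField (𝓡 d) (stdBasis d) x i ((extChartAt (𝓡 d) x).symm y) =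
      mfderiv 𝓘(ℝ, EuclideanSpace ℝ (Fin d)) (𝓡 d) (extChartAt (𝓡 d) x).symm y
        (EuclideanSpace.single i 1) := by
    intro i
    have h1 := coordField_eq_mfderiv (I := 𝓡 d) (stdBasis d) x i hp
    rw [(extChartAt (𝓡 d) x).right_inv hy, stdBasis_apply] at h1
    exact h1
  simp only [gramMatrix, coordGram, pairing, Matrix.of_apply, h]

lemma contDiffAt_coordDensity {y : EuclideanSpace ℝ (Fin d)}
    (hy : y ∈ (extChartAt (𝓡 d) x).target) :
    ContDiffAt ℝ ∞ (coordDensity g (stdBasis d) x) y := by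
  have hp := extChartAt_symm_mem_source (I := 𝓡 d) x hy
  have h1 := contMDiffAt_det fun i j ↦ contMDiffAt_coordGram g (stdBasis d) x i j hp
  exact (contDiffAt_comp_extChartAt_symm (I := 𝓡 d) (n := ⊤) x hy h1).sqrt
    (coordGram_det_pos g (stdBasis d) x hp).ne'

lemma continuousOn_coordDensity :
    ContinuousOn (coordDensity g (stdBasis d) x) (extChartAt (𝓡 d) x).target := fun _ hy ↦
  (contDiffAt_coordDensity g x hy).continuousAt.continuousWithinAt

lemma coordDensity_pos {y : EuclideanSpace ℝ (Fin d)} (hy : y ∈ (extChartAt (𝓡 d) x).target) :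
    0 < coordDensity g (stdBasis d) x y :=
  Real.sqrt_pos.2 (coordGram_det_pos g _ x (extChartAt_symm_mem_source (I := 𝓡 d) x hy))

lemma aemeasurable_coordDensity : AEMeasurable
    (fun y ↦ ENNReal.ofReal (coordDensity g (stdBasis d) x y))
    (volume.restrict (extChartAt (𝓡 d) x).target) :=
  ((continuousOn_coordDensity g x).aemeasurable
    (isOpen_extChartAt_target (I := 𝓡 d) x).measurableSet).ennreal_ofReal

variable [MeasurableSpace M]

lemma chartVolume_eq_map : chartVolume g x =
    ((volume.restrict (extChartAt (𝓡 d) x).target).withDensity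
      fun y ↦ ENNReal.ofReal (coordDensity g (stdBasis d) x y)).map (extChartAt (𝓡 d) x).symm := by
  rw [chartVolume]
  congr 1
  refine withDensity_congr_ae ?_
  filter_upwards [ae_restrict_mem (isOpen_extChartAt_target (I := 𝓡 d) x).measurableSet] with y hy
  rw [gramMatrix_eq_coordGram g x hy, coordDensity]

variable [BorelSpace M]

lemma aemeasurable_extChartAt_symm : AEMeasurable (extChartAt (𝓡 d) x).symm
    ((volume.restrict (extChartAt (𝓡 d) x).target).withDensity
      fun y ↦ ENNReal.ofReal (coordDensity g (stdBasis d) x y)) :=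
  ((continuousOn_extChartAt_symm x).aemeasurable
    (isOpen_extChartAt_target (I := 𝓡 d) x).measurableSet).mono_ac
    (withDensity_absolutelyContinuous _ _)

lemma measurableSet_extChartAt_image {A : Set M} (hA : MeasurableSet A)
    (hAx : A ⊆ (extChartAt (𝓡 d) x).source) : MeasurableSet (extChartAt (𝓡 d) x '' A) := by
  have h1 : extChartAt (𝓡 d) x '' A = Subtype.val ''
      ((fun y : (extChartAt (𝓡 d) x).target ↦ (extChartAt (𝓡 d) x).symm y) ⁻¹' A) := by
    rw [(extChartAt (𝓡 d) x).image_eq_target_inter_inv_preimage hAx]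
    ext y
    simp [and_comm]
  rw [h1]
  refine (isOpen_extChartAt_target (I := 𝓡 d) x).measurableSet.subtype_image ?_
  exact ((continuousOn_iff_continuous_domRestrict.1
    (continuousOn_extChartAt_symm (I := 𝓡 d) x)).measurable) hA

lemma chartVolume_apply {A : Set M} (hA : MeasurableSet A)
    (hAx : A ⊆ (extChartAt (𝓡 d) x).source) : chartVolume g x A =
      ∫⁻ y in extChartAt (𝓡 d) x '' A, ENNReal.ofReal (coordDensity g (stdBasis d) x y) := by
  have hm := measurableSet_extChartAt_image x hA hAx
  have hAE := aemeasurable_extChartAt_symm g x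
  rw [chartVolume_eq_map, Measure.map_apply_of_aemeasurable hAE hA,
    withDensity_apply', Measure.restrict_restrict₀]
  · congr 2
    rw [(extChartAt (𝓡 d) x).image_eq_target_inter_inv_preimage hAx, Set.inter_comm]
  · exact ((continuousOn_extChartAt_symm x).aemeasurable
      (isOpen_extChartAt_target (I := 𝓡 d) x).measurableSet).nullMeasurableSet_preimage hA

lemma chartVolume_compl_source : chartVolume g x (extChartAt (𝓡 d) x).sourceᶜ = 0 := by
  have hs := (isOpen_extChartAt_source (I := 𝓡 d) x).measurableSet
  rw [chartVolume_eq_map, Measure.map_apply_of_aemeasurable (aemeasurable_extChartAt_symm g x)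
    hs.compl]
  refine withDensity_absolutelyContinuous _ _ ?_
  refine measure_mono_null (t := (extChartAt (𝓡 d) x).targetᶜ) (fun y hy hyt ↦
    hy ((extChartAt (𝓡 d) x).map_target hyt)) ?_
  rw [Measure.restrict_apply (isOpen_extChartAt_target (I := 𝓡 d) x).measurableSet.compl]
  simp

end VolumeCharts

section VolumeOverlap

open scoped ENNReal

variable {d : ℕ} {M : Type*} [TopologicalSpace M] [ChartedSpace (EuclideanSpace ℝ (Fin d)) M]
  [IsManifold (𝓡 d) ∞ M] (g : SmoothMetric (𝓡 d) M) (x x' : M)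

lemma hasFDerivAt_transition {y : EuclideanSpace ℝ (Fin d)} (hy : y ∈ (extChartAt (𝓡 d) x).target)
    (hy' : (extChartAt (𝓡 d) x).symm y ∈ (chartAt (EuclideanSpace ℝ (Fin d)) x').source) :
    HasFDerivAt (extChartAt (𝓡 d) x' ∘ (extChartAt (𝓡 d) x).symm)
      (fderiv ℝ (extChartAt (𝓡 d) x' ∘ (extChartAt (𝓡 d) x).symm) y) y :=
  DifferentiableAt.hasFDerivAt <| (((contMDiffAt_extChartAt' (I := 𝓡 d) (n := ∞) hy').comp y
    (contMDiffAt_extChartAt_symm (I := 𝓡 d) (n := ⊤) x hy)).contDiffAt).differentiableAt (by simp)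

/-- The coordinate vector fields of two charts are related by the Jacobian of the transition. -/
lemma coordField_eq_sum_transition {y : EuclideanSpace ℝ (Fin d)}
    (hy : y ∈ (extChartAt (𝓡 d) x).target)
    (hy' : (extChartAt (𝓡 d) x).symm y ∈ (chartAt (EuclideanSpace ℝ (Fin d)) x').source)
    (i : Fin d) :
    coordField (𝓡 d) (stdBasis d) x i ((extChartAt (𝓡 d) x).symm y) =
      ∑ k, (fderiv ℝ (extChartAt (𝓡 d) x' ∘ (extChartAt (𝓡 d) x).symm) y (stdBasis d i)) k •
        coordField (𝓡 d) (stdBasis d) x' k ((extChartAt (𝓡 d) x).symm y) := by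
  set p := (extChartAt (𝓡 d) x).symm y with hpdef
  have hp := extChartAt_symm_mem_source (I := 𝓡 d) x hy
  have hyp : extChartAt (𝓡 d) x p = y := (extChartAt (𝓡 d) x).right_inv hy
  have hp' : p ∈ (extChartAt (𝓡 d) x').source := by simpa using hy'
  have hpt' := (extChartAt (𝓡 d) x').map_source hp'
  set τ := extChartAt (𝓡 d) x' ∘ (extChartAt (𝓡 d) x).symm with hτ
  have hd1 := (contMDiffAt_extChartAt_symm (I := 𝓡 d) (n := 1) x hy).mdifferentiableAt (by simp)
  have hd2 := (contMDiffAt_extChartAt_symm (I := 𝓡 d) (n := 1) x' hpt').mdifferentiableAt (by simp)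
  have hev : (extChartAt (𝓡 d) x).symm =ᶠ[nhds y] (extChartAt (𝓡 d) x').symm ∘ τ := by
    have := hd1.continuousAt.preimage_mem_nhds
      ((isOpen_extChartAt_source (I := 𝓡 d) x').mem_nhds hp')
    filter_upwards [this] with z hz
    exact ((extChartAt (𝓡 d) x').left_inv hz).symm
  have hτd := hasFDerivAt_transition x x' hy hy'
  have hchain : mfderiv 𝓘(ℝ, EuclideanSpace ℝ (Fin d)) (𝓡 d) (extChartAt (𝓡 d) x).symm y =
      (mfderiv 𝓘(ℝ, EuclideanSpace ℝ (Fin d)) (𝓡 d) (extChartAt (𝓡 d) x').symm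
        (τ y)).comp (fderiv ℝ τ y) :=
    ((HasMFDerivAt.comp (I := 𝓘(ℝ, EuclideanSpace ℝ (Fin d)))
      (I' := 𝓘(ℝ, EuclideanSpace ℝ (Fin d))) y hd2.hasMFDerivAt
      hτd.hasMFDerivAt).congr_of_eventuallyEq hev).mfderiv
  have h1 := coordField_eq_mfderiv (I := 𝓡 d) (stdBasis d) x i hp
  have h2 := fun k ↦ coordField_eq_mfderiv (I := 𝓡 d) (stdBasis d) x' k hy'
  rw [hyp] at h1
  let A : EuclideanSpace ℝ (Fin d) →L[ℝ] EuclideanSpace ℝ (Fin d) :=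
    mfderiv 𝓘(ℝ, EuclideanSpace ℝ (Fin d)) (𝓡 d) (extChartAt (𝓡 d) x').symm (τ y)
  set w := fderiv ℝ τ y (stdBasis d i) with hw
  have h3 : A w = ∑ k, w k • A (stdBasis d k) := by
    conv_lhs => rw [← (stdBasis d).sum_repr w, map_sum]
    exact Finset.sum_congr rfl fun k _ ↦ by rw [map_smul]; rfl
  have h4 : coordField (𝓡 d) (stdBasis d) x i p = A w := h1.trans
    (congrArg (fun B : EuclideanSpace ℝ (Fin d) →L[ℝ] EuclideanSpace ℝ (Fin d) ↦
      B (stdBasis d i)) hchain)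
  exact h4.trans (h3.trans (Finset.sum_congr rfl fun k _ ↦
    congrArg (fun v : EuclideanSpace ℝ (Fin d) ↦ w k • v) (h2 k).symm))

lemma coordGram_transition {y : EuclideanSpace ℝ (Fin d)}
    (hy : y ∈ (extChartAt (𝓡 d) x).target)
    (hy' : (extChartAt (𝓡 d) x).symm y ∈ (chartAt (EuclideanSpace ℝ (Fin d)) x').source) :
    coordGram g (stdBasis d) x ((extChartAt (𝓡 d) x).symm y) =
      (LinearMap.toMatrix (stdBasis d) (stdBasis d)
        (fderiv ℝ (extChartAt (𝓡 d) x' ∘ (extChartAt (𝓡 d) x).symm) y).toLinearMap).transpose *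
      coordGram g (stdBasis d) x' ((extChartAt (𝓡 d) x).symm y) *
      (LinearMap.toMatrix (stdBasis d) (stdBasis d)
        (fderiv ℝ (extChartAt (𝓡 d) x' ∘ (extChartAt (𝓡 d) x).symm) y).toLinearMap) := by
  ext i j
  rw [coordGram, Matrix.of_apply, pairing, coordField_eq_sum_transition x x' hy hy' i,
    coordField_eq_sum_transition x x' hy hy' j]
  simp only [map_sum, map_smul, sum_apply, smul_apply, smul_eq_mul, Matrix.mul_apply,
    Matrix.transpose_apply, LinearMap.toMatrix_apply, coordGram, Matrix.of_apply, pairing,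
    Finset.mul_sum, Finset.sum_mul]
  refine Finset.sum_congr rfl fun k _ ↦ Finset.sum_congr rfl fun l _ ↦ ?_
  simp [stdBasis]
  ring

lemma coordDensity_transition {y : EuclideanSpace ℝ (Fin d)}
    (hy : y ∈ (extChartAt (𝓡 d) x).target)
    (hy' : (extChartAt (𝓡 d) x).symm y ∈ (chartAt (EuclideanSpace ℝ (Fin d)) x').source) :
    coordDensity g (stdBasis d) x y =
      |(fderiv ℝ (extChartAt (𝓡 d) x' ∘ (extChartAt (𝓡 d) x).symm) y).det| *
      coordDensity g (stdBasis d) x' ((extChartAt (𝓡 d) x' ∘ (extChartAt (𝓡 d) x).symm) y) := by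
  have hp' : (extChartAt (𝓡 d) x).symm y ∈ (extChartAt (𝓡 d) x').source := by simpa using hy'
  rw [coordDensity, coordDensity, coordGram_transition g x x' hy hy', Function.comp_apply,
    (extChartAt (𝓡 d) x').left_inv hp', Matrix.det_mul, Matrix.det_mul, Matrix.det_transpose,
    LinearMap.det_toMatrix, ContinuousLinearMap.det, mul_right_comm, Real.sqrt_mul
      (mul_self_nonneg _), Real.sqrt_mul_self_eq_abs]

variable [MeasurableSpace M] [BorelSpace M]

/-- The local Riemannian measures of two charts agree on the overlap. -/
lemma chartVolume_overlap {A : Set M} (hA : MeasurableSet A)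
    (hAx : A ⊆ (extChartAt (𝓡 d) x).source) (hAx' : A ⊆ (extChartAt (𝓡 d) x').source) :
    chartVolume g x A = chartVolume g x' A := by
  rw [chartVolume_apply g x hA hAx, chartVolume_apply g x' hA hAx']
  set τ := extChartAt (𝓡 d) x' ∘ (extChartAt (𝓡 d) x).symm with hτ
  have himg : extChartAt (𝓡 d) x' '' A = τ '' (extChartAt (𝓡 d) x '' A) := by
    rw [hτ, Set.image_comp, (extChartAt (𝓡 d) x).symm_image_image_of_subset_source hAx]
  have hmem : ∀ y ∈ extChartAt (𝓡 d) x '' A, y ∈ (extChartAt (𝓡 d) x).target ∧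
      (extChartAt (𝓡 d) x).symm y ∈ A := by
    rintro _ ⟨p, hp, rfl⟩
    exact ⟨(extChartAt (𝓡 d) x).map_source (hAx hp),
      by rwa [(extChartAt (𝓡 d) x).left_inv (hAx hp)]⟩
  have hmem' : ∀ y ∈ extChartAt (𝓡 d) x '' A, (extChartAt (𝓡 d) x).symm y ∈
      (chartAt (EuclideanSpace ℝ (Fin d)) x').source := fun y hy ↦ by
    simpa using hAx' (hmem y hy).2
  have hinj : Set.InjOn τ (extChartAt (𝓡 d) x '' A) :=
    (extChartAt (𝓡 d) x').injOn.comp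
      ((extChartAt (𝓡 d) x).symm.injOn.mono fun y hy ↦ (hmem y hy).1)
      fun y hy ↦ hAx' (hmem y hy).2
  rw [himg, lintegral_image_eq_lintegral_abs_det_fderiv_mul volume
    (measurableSet_extChartAt_image x hA hAx)
    (fun y hy ↦ (hasFDerivAt_transition x x' (hmem y hy).1 (hmem' y hy)).hasFDerivWithinAt) hinj]
  refine setLIntegral_congr_fun (measurableSet_extChartAt_image x hA hAx) fun y hy ↦ ?_
  rw [coordDensity_transition g x x' (hmem y hy).1 (hmem' y hy), ENNReal.ofReal_mul (abs_nonneg _)]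

/-- The Riemannian volume restricts to the local measure on each chart domain. -/
lemma riemannianVolume_restrict_source :
    (riemannianVolume g).restrict (extChartAt (𝓡 d) x).source = chartVolume g x := by
  have hs : ∀ z : M, MeasurableSet (extChartAt (𝓡 d) z).source := fun z ↦
    (isOpen_extChartAt_source (I := 𝓡 d) z).measurableSet
  have hres : (chartVolume g x).restrict (extChartAt (𝓡 d) x).source = chartVolume g x :=
    Measure.restrict_eq_self_of_ae_mem
      (by rw [ae_iff]; exact chartVolume_compl_source g x)
  apply le_antisymm
  · have hle : riemannianVolume g ≤ chartVolume g x +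
        (⊤ : Measure M).restrict (extChartAt (𝓡 d) x).sourceᶜ := by
      refine iSup_le fun z ↦ ?_
      rw [← Measure.restrict_add_restrict_compl (μ := chartVolume g z) (hs x)]
      refine add_le_add (Measure.le_iff.2 fun A hA ↦ ?_)
        (Measure.restrict_mono le_rfl le_top)
      rw [Measure.restrict_apply hA]
      have hz : chartVolume g z (A ∩ (extChartAt (𝓡 d) x).source) = chartVolume g z
          (A ∩ (extChartAt (𝓡 d) x).source ∩ (extChartAt (𝓡 d) z).source) := by
        refine (measure_inter_conull ?_).symm
        exact chartVolume_compl_source g z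
      rw [hz, ← chartVolume_overlap g x z ((hA.inter (hs x)).inter (hs z))
        (fun q hq ↦ hq.1.2) (fun q hq ↦ hq.2)]
      exact measure_mono fun q hq ↦ hq.1.1
    refine (Measure.restrict_mono le_rfl hle).trans ?_
    rw [Measure.restrict_add, Measure.restrict_restrict (hs x)]
    simpa using hres.le
  · rw [← hres]
    exact Measure.restrict_mono le_rfl (le_iSup (fun z ↦ chartVolume g z) x)

end VolumeOverlap

section DivergenceTheorem

variable {d : ℕ} {M : Type*} [TopologicalSpace M] [ChartedSpace (EuclideanSpace ℝ (Fin d)) M]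
  [IsManifold (𝓡 d) ∞ M] (g : SmoothMetric (𝓡 d) M)

lemma integral_fderiv_eq_zero {E : Type*} [NormedAddCommGroup E] [NormedSpace ℝ E]
    [FiniteDimensional ℝ E] [MeasurableSpace E] [BorelSpace E] (μ : Measure E)
    [μ.IsAddHaarMeasure] {u : E → ℝ} (hu : ContDiff ℝ 1 u) (hc : HasCompactSupport u) (v : E) :
    ∫ y, fderiv ℝ u y v ∂μ = 0 := by
  have h1 : Integrable u μ := hu.continuous.integrable_of_hasCompactSupport hc
  have h2 : Integrable (fun y ↦ fderiv ℝ u y v) μ :=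
    ((hu.continuous_fderiv (by simp)).clm_apply continuous_const).integrable_of_hasCompactSupport
      (hc.fderiv_apply ℝ v)
  have := integral_mul_fderiv_eq_neg_fderiv_mul_of_integrable (μ := μ) (f := fun _ : E ↦ (1 : ℝ))
    (g := u) (v := v) (by simp) (by simpa using h2) (by simpa using h1)
    (fun y _ ↦ differentiableAt_const _) (fun y _ ↦ hu.differentiable (by simp) y)
  simpa using this

lemma contDiffAt_coordDensity_mul_coordComp (x : M) {X : Π p : M, TangentSpace (𝓡 d) p}
    (hX : ContMDiff (𝓡 d) ((𝓡 d).prod 𝓘(ℝ, EuclideanSpace ℝ (Fin d))) ∞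
      (fun p ↦ (⟨p, X p⟩ : TangentBundle (𝓡 d) M))) (j : Fin d)
    {y : EuclideanSpace ℝ (Fin d)} (hy : y ∈ (extChartAt (𝓡 d) x).target) :
    ContDiffAt ℝ ∞ (fun z ↦ coordDensity g (stdBasis d) x z *
      coordComp (𝓡 d) (stdBasis d) x X j ((extChartAt (𝓡 d) x).symm z)) y :=
  (contDiffAt_coordDensity g x hy).mul <|
    contDiffAt_comp_extChartAt_symm (I := 𝓡 d) (n := ⊤) x hy
      (contMDiffAt_coordComp (n := ⊤) (stdBasis d) x (hX _) j
        (extChartAt_symm_mem_source (I := 𝓡 d) x hy))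

lemma continuous_divergence {X : Π p : M, TangentSpace (𝓡 d) p}
    (hX : ContMDiff (𝓡 d) ((𝓡 d).prod 𝓘(ℝ, EuclideanSpace ℝ (Fin d))) ∞
      (fun p ↦ (⟨p, X p⟩ : TangentBundle (𝓡 d) M))) : Continuous (divergence g X) := by
  refine continuous_iff_continuousAt.2 fun p ↦ ?_
  have hp : p ∈ (extChartAt (𝓡 d) p).source := mem_extChartAt_source p
  have hpt := (extChartAt (𝓡 d) p).map_source hp
  have h1 : ContinuousAt (fun y ↦ (coordDensity g (stdBasis d) p y)⁻¹ *
      ∑ j, fderiv ℝ (fun z ↦ coordDensity g (stdBasis d) p z *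
      coordComp (𝓡 d) (stdBasis d) p X j ((extChartAt (𝓡 d) p).symm z)) y (stdBasis d j))
      (extChartAt (𝓡 d) p p) := by
    refine ((contDiffAt_coordDensity g p hpt).continuousAt.inv₀ (coordDensity_pos g p hpt).ne').mul
      (tendsto_finsetSum _ fun j _ ↦ ?_)
    exact ((contDiffAt_coordDensity_mul_coordComp g p hX j hpt).fderiv_right (m := 0)
      (by simp)).continuousAt.clm_apply continuousAt_const
  refine (h1.comp (continuousAt_extChartAt (I := 𝓡 d) p)).congr ?_
  filter_upwards [(isOpen_extChartAt_source (I := 𝓡 d) p).mem_nhds hp] with q hq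
  have hqt := (extChartAt (𝓡 d) p).map_source hq
  have h2 := coordDensity_mul_divergence (I := 𝓡 d) g (stdBasis d) p hqt
    (hX.mdifferentiableAt (by simp))
  rw [Function.comp_apply, ← h2, (extChartAt (𝓡 d) p).left_inv hq,
    inv_mul_cancel_left₀ (coordDensity_pos g p hqt).ne']

lemma divergence_eq_zero_of_notMem {X : Π p : M, TangentSpace (𝓡 d) p} {K : Set M}
    (hK : IsClosed K) (hXK : ∀ p ∉ K, X p = 0) {p : M} (hp : p ∉ K) : divergence g X p = 0 := by
  have hev : ∀ᶠ q in nhds p, (0 : Π p : M, TangentSpace (𝓡 d) p) q = X q := by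
    filter_upwards [hK.isOpen_compl.mem_nhds hp] with q hq
    exact (hXK q hq).symm
  have h0 : MDifferentiableAt (𝓡 d) ((𝓡 d).prod 𝓘(ℝ, EuclideanSpace ℝ (Fin d)))
      (fun p ↦ (⟨p, (0 : Π p : M, TangentSpace (𝓡 d) p) p⟩ : TangentBundle (𝓡 d) M)) p :=
    mdifferentiableAt_zeroSection ..
  rw [← divergence_congr g h0 (h0.congr_of_eventuallyEq (hev.mono fun q hq ↦ by simp [← hq])) hev,
    divergence, (leviCivita g).zero]
  exact map_zero _

variable [MeasurableSpace M] [BorelSpace M]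

instance : IsLocallyFiniteMeasure (riemannianVolume g) := by
  refine ⟨fun p ↦ ?_⟩
  have hp : p ∈ (extChartAt (𝓡 d) p).source := mem_extChartAt_source p
  have hpt := (extChartAt (𝓡 d) p).map_source hp
  obtain ⟨r, hr, hrt⟩ := Metric.nhds_basis_closedBall.mem_iff.1
    ((isOpen_extChartAt_target (I := 𝓡 d) p).mem_nhds hpt)
  have hB := isCompact_closedBall (extChartAt (𝓡 d) p p) r
  set U := (extChartAt (𝓡 d) p).source ∩ extChartAt (𝓡 d) p ⁻¹'
    Metric.ball (extChartAt (𝓡 d) p p) r with hU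
  have hUo : IsOpen U := (continuousOn_extChartAt (I := 𝓡 d) p).isOpen_inter_preimage
    (isOpen_extChartAt_source (I := 𝓡 d) p) Metric.isOpen_ball
  refine ⟨U, hUo.mem_nhds ⟨hp, Metric.mem_ball_self hr⟩, ?_⟩
  have hUs : U ⊆ (extChartAt (𝓡 d) p).source := Set.inter_subset_left
  rw [← Set.inter_eq_left.2 hUs, ← Measure.restrict_apply hUo.measurableSet,
    riemannianVolume_restrict_source, chartVolume_apply g p hUo.measurableSet hUs]
  obtain ⟨C, hC⟩ := hB.exists_bound_of_continuousOn
    ((continuousOn_coordDensity g p).mono hrt)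
  have himg : extChartAt (𝓡 d) p '' U ⊆ Metric.closedBall (extChartAt (𝓡 d) p p) r := by
    rintro _ ⟨q, hq, rfl⟩
    exact Metric.ball_subset_closedBall hq.2
  refine (lintegral_mono_set himg).trans_lt ?_
  refine (setLIntegral_mono (g := fun _ ↦ ENNReal.ofReal C) measurable_const
    fun y hy ↦ ENNReal.ofReal_le_ofReal ((le_abs_self _).trans (hC y hy))).trans_lt ?_
  rw [setLIntegral_const]
  exact ENNReal.mul_lt_top ENNReal.ofReal_lt_top hB.measure_lt_top

lemma integral_eq_integral_chart (x : M) {f : M → ℝ} (hf : Continuous f)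
    (hfx : ∀ p ∉ (extChartAt (𝓡 d) x).source, f p = 0) :
    ∫ p, f p ∂(riemannianVolume g) = ∫ y in (extChartAt (𝓡 d) x).target,
      coordDensity g (stdBasis d) x y * f ((extChartAt (𝓡 d) x).symm y) := by
  rw [← setIntegral_eq_integral_of_forall_compl_eq_zero hfx, riemannianVolume_restrict_source,
    chartVolume_eq_map, integral_map (aemeasurable_extChartAt_symm g x)
      hf.measurable.aestronglyMeasurable,
    integral_withDensity_eq_integral_toReal_smul₀ (aemeasurable_coordDensity g x)
      (Filter.Eventually.of_forall fun _ ↦ ENNReal.ofReal_lt_top)]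
  refine integral_congr_ae ?_
  filter_upwards [ae_restrict_mem (isOpen_extChartAt_target (I := 𝓡 d) x).measurableSet] with y hy
  rw [ENNReal.toReal_ofReal (coordDensity_pos g x hy).le, smul_eq_mul]

lemma integral_divergence_eq_zero_of_chart (x : M) {X : Π p : M, TangentSpace (𝓡 d) p}
    [T2Space M]
    (hX : ContMDiff (𝓡 d) ((𝓡 d).prod 𝓘(ℝ, EuclideanSpace ℝ (Fin d))) ∞
      (fun p ↦ (⟨p, X p⟩ : TangentBundle (𝓡 d) M))) {K : Set M} (hK : IsCompact K)
    (hXK : ∀ p ∉ K, X p = 0) (hKx : K ⊆ (extChartAt (𝓡 d) x).source) :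
    ∫ p, divergence g X p ∂(riemannianVolume g) = 0 := by
  classical
  have hxt := isOpen_extChartAt_target (I := 𝓡 d) x
  rw [integral_eq_integral_chart g x (continuous_divergence g hX) fun p hp ↦
    divergence_eq_zero_of_notMem g hK.isClosed hXK fun h ↦ hp (hKx h)]
  set u : Fin d → EuclideanSpace ℝ (Fin d) → ℝ := fun j z ↦ coordDensity g (stdBasis d) x z *
      coordComp (𝓡 d) (stdBasis d) x X j ((extChartAt (𝓡 d) x).symm z) with hu
  set w : Fin d → EuclideanSpace ℝ (Fin d) → ℝ := fun j ↦
    (extChartAt (𝓡 d) x).target.indicator (u j)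
    with hw
  set K' := extChartAt (𝓡 d) x '' K with hK'
  have hK'c : IsCompact K' := hK.image_of_continuousOn ((continuousOn_extChartAt x).mono hKx)
  have hK't : K' ⊆ (extChartAt (𝓡 d) x).target := by
    rintro _ ⟨q, hq, rfl⟩
    exact (extChartAt (𝓡 d) x).map_source (hKx hq)
  have hwK : ∀ j, ∀ y ∉ K', w j y = 0 := fun j y hy ↦ by
    by_cases hyt : y ∈ (extChartAt (𝓡 d) x).target
    · rw [hw]
      simp only [Set.indicator_of_mem hyt, hu]
      have : (extChartAt (𝓡 d) x).symm y ∉ K := fun h ↦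
        hy ⟨_, h, (extChartAt (𝓡 d) x).right_inv hyt⟩
      rw [coordComp, hXK _ this, map_zero, mul_zero]
    · exact Set.indicator_of_notMem hyt _
  have hweq : ∀ j, ∀ y ∈ (extChartAt (𝓡 d) x).target, w j =ᶠ[nhds y] u j := fun j y hy ↦ by
    filter_upwards [hxt.mem_nhds hy] with z hz
    exact Set.indicator_of_mem hz _
  have hwz : ∀ j, ∀ y ∉ K', w j =ᶠ[nhds y] fun _ ↦ 0 := fun j y hy ↦ by
    filter_upwards [hK'c.isClosed.isOpen_compl.mem_nhds hy] with z hz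
    exact hwK j z hz
  have hws : ∀ j, ContDiff ℝ 1 (w j) := fun j ↦ contDiff_iff_contDiffAt.2 fun y ↦ by
    by_cases hy : y ∈ K'
    · exact ((contDiffAt_coordDensity_mul_coordComp g x hX j (hK't hy)).of_le
        (ENat.LEInfty.out)).congr_of_eventuallyEq (hweq j y (hK't hy))
    · exact contDiffAt_const.congr_of_eventuallyEq (hwz j y hy)
  have hwc : ∀ j, HasCompactSupport (w j) := fun j ↦ HasCompactSupport.intro hK'c (hwK j)
  have hint : ∀ j, Integrable (fun y ↦ fderiv ℝ (w j) y (stdBasis d j)) := fun j ↦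
    (((hws j).continuous_fderiv (by simp)).clm_apply
      continuous_const).integrable_of_hasCompactSupport ((hwc j).fderiv_apply ℝ _)
  calc _ = ∫ y in (extChartAt (𝓡 d) x).target, ∑ j, fderiv ℝ (w j) y (stdBasis d j) := by
        refine setIntegral_congr_fun hxt.measurableSet fun y hy ↦ ?_
        rw [coordDensity_mul_divergence (I := 𝓡 d) g (stdBasis d) x hy
          (hX.mdifferentiableAt (by simp))]
        exact Finset.sum_congr rfl fun j _ ↦ by rw [(hweq j y hy).fderiv_eq]
    _ = ∫ y, ∑ j, fderiv ℝ (w j) y (stdBasis d j) := by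
        refine setIntegral_eq_integral_of_forall_compl_eq_zero fun y hy ↦ ?_
        refine Finset.sum_eq_zero fun j _ ↦ ?_
        rw [(hwz j y fun h ↦ hy (hK't h)).fderiv_eq]
        simp
    _ = 0 := by
        rw [integral_finsetSum _ fun j _ ↦ hint j]
        exact Finset.sum_eq_zero fun j _ ↦ integral_fderiv_eq_zero _ (hws j) (hwc j) _

/-- The divergence theorem for compactly supported vector fields. -/
theorem integral_divergence_eq_zero [T2Space M] [SecondCountableTopology M]
    {X : Π p : M, TangentSpace (𝓡 d) p}
    (hX : ContMDiff (𝓡 d) ((𝓡 d).prod 𝓘(ℝ, EuclideanSpace ℝ (Fin d))) ∞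
      (fun p ↦ (⟨p, X p⟩ : TangentBundle (𝓡 d) M))) {K : Set M} (hK : IsCompact K)
    (hXK : ∀ p ∉ K, X p = 0) :
    ∫ p, divergence g X p ∂(riemannianVolume g) = 0 := by
  have : LocallyCompactSpace M := ChartedSpace.locallyCompactSpace (EuclideanSpace ℝ (Fin d)) M
  obtain ⟨f, hf⟩ := SmoothPartitionOfUnity.exists_isSubordinate_chartAt_source (𝓡 d) M
  have hfin : {i | (Function.support (f i) ∩ K).Nonempty}.Finite :=
    f.locallyFinite.finite_nonempty_inter_compact hK
  set S := hfin.toFinset with hS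
  have hXi : ∀ i, ContMDiff (𝓡 d) ((𝓡 d).prod 𝓘(ℝ, EuclideanSpace ℝ (Fin d))) ∞
      (fun p ↦ (⟨p, ((f i : M → ℝ) • X) p⟩ : TangentBundle (𝓡 d) M)) := fun i ↦
    (f i).contMDiff.smul_section hX
  have hsum : X = ∑ i ∈ S, (f i : M → ℝ) • X := by
    funext p
    by_cases hp : p ∈ K
    · have h1 : ∑ i ∈ S, f i p = 1 := by
        rw [← f.sum_eq_one (Set.mem_univ p)]
        refine (finsum_eq_sum_of_support_subset _ fun i hi ↦ ?_).symm
        simpa [hS] using ⟨p, hi, hp⟩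
      simp only [Finset.sum_apply, Pi.smul_apply']
      rw [← Finset.sum_smul, h1, one_smul]
    · simp [hXK p hp]
  have hz : ∀ i, ∀ p ∉ K ∩ tsupport (f i), ((f i : M → ℝ) • X) p = 0 := fun i p hp ↦ by
    by_cases hpK : p ∈ K
    · have : f i p = 0 := image_eq_zero_of_notMem_tsupport fun h ↦ hp ⟨hpK, h⟩
      simp [this]
    · simp [hXK p hpK]
  have hKi : ∀ i, IsCompact (K ∩ tsupport (f i)) := fun i ↦ hK.inter_right (isClosed_tsupport _)
  have hint : ∀ i ∈ S, Integrable (divergence g ((f i : M → ℝ) • X)) (riemannianVolume g) :=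
    fun i _ ↦ (continuous_divergence g (hXi i)).integrable_of_hasCompactSupport
      (HasCompactSupport.intro (hKi i) fun p hp ↦
        divergence_eq_zero_of_notMem g (hKi i).isClosed (hz i) hp)
  have hdiv : ∀ p, divergence g X p = ∑ i ∈ S, divergence g ((f i : M → ℝ) • X) p := fun p ↦ by
    conv_lhs => rw [hsum]
    exact divergence_sum g S fun i _ ↦ (hXi i).mdifferentiableAt (by simp)
  simp only [hdiv]
  rw [integral_finsetSum _ hint]
  refine Finset.sum_eq_zero fun i _ ↦ ?_
  refine integral_divergence_eq_zero_of_chart g i (hXi i) (hKi i) (hz i) ?_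
  rw [extChartAt_source]
  exact Set.inter_subset_right.trans (hf i)

end DivergenceTheorem

section TraceInequality

variable {W : Type*} [AddCommGroup W] [Module ℝ W] [FiniteDimensional ℝ W]

lemma exists_orthonormal_basis (B : LinearMap.BilinForm ℝ W) (hs : ∀ v w, B v w = B w v)
    (hpos : ∀ v, v ≠ 0 → 0 < B v v) :
    ∃ e : Module.Basis (Fin (Module.finrank ℝ W)) ℝ W, ∀ v i, e.repr v i = B v (e i) := by
  have hnn : ∀ v, 0 ≤ B v v := fun v ↦ by
    by_cases h : v = 0
    · simp [h]
    · exact (hpos v h).le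
  let core : InnerProductSpace.Core ℝ W :=
    { inner := fun v w ↦ B v w
      conj_inner_symm := fun v w ↦ by simp [hs v w]
      re_inner_nonneg := fun v ↦ hnn v
      add_left := fun u v w ↦ by simp
      smul_left := fun v w r ↦ by simp
      definite := fun v hv ↦ by
        by_contra h
        exact (hpos v h).ne' hv }
  let _ : NormedAddCommGroup W := core.toNormedAddCommGroup
  let _ : InnerProductSpace ℝ W := InnerProductSpace.ofCore core.toCore
  refine ⟨(stdOrthonormalBasis ℝ W).toBasis, fun v i ↦ ?_⟩
  rw [OrthonormalBasis.coe_toBasis_repr_apply, OrthonormalBasis.repr_apply_apply,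
    OrthonormalBasis.coe_toBasis, hs]
  rfl

/-- For a positive semidefinite symmetric endomorphism `A`, `|Av|² ≤ tr(A) ⟨Av, v⟩`. -/
lemma apply_sq_le_trace_mul (B : LinearMap.BilinForm ℝ W) (hs : ∀ v w, B v w = B w v)
    (hpos : ∀ v, v ≠ 0 → 0 < B v v) (A : W →ₗ[ℝ] W) (hA : ∀ v w, B (A v) w = B v (A w))
    (hA0 : ∀ v, 0 ≤ B (A v) v) (v : W) :
    B (A v) (A v) ≤ LinearMap.trace ℝ W A * B (A v) v := by
  obtain ⟨e, he⟩ := exists_orthonormal_basis B hs hpos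
  have htr : LinearMap.trace ℝ W A = ∑ i, B (A (e i)) (e i) := by
    rw [LinearMap.trace_eq_matrix_trace ℝ e, Matrix.trace]
    simp [LinearMap.toMatrix_apply, he]
  have hsq : B (A v) (A v) = ∑ i, B (A v) (e i) * B (A v) (e i) := by
    have h1 : B (A v) (A v) = B (A v) (∑ i, e.repr (A v) i • e i) := by rw [e.sum_repr]
    rw [h1, map_sum]
    exact Finset.sum_congr rfl fun i _ ↦ by rw [map_smul, smul_eq_mul, he]
  rw [hsq, htr, Finset.sum_mul]
  refine Finset.sum_le_sum fun i _ ↦ ?_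
  have h := LinearMap.BilinForm.apply_mul_apply_le_of_forall_zero_le (B ∘ₗ A) hA0 v (e i)
  simp only [LinearMap.comp_apply] at h
  rw [hA (e i) v, hs (e i)] at h
  linarith

end TraceInequality

section Cone

variable {E : Type*} [NormedAddCommGroup E] [NormedSpace ℝ E] [FiniteDimensional ℝ E]
  {H : Type*} [TopologicalSpace H] {I : ModelWithCorners ℝ E H}
  {M : Type*} [TopologicalSpace M] [ChartedSpace H M] [IsManifold I ∞ M]
  (g : SmoothMetric I M) {V : Π p : M, TangentSpace I p} {f u : M → ℝ} {p : M}

lemma mlieBracket_eq_leviCivita {X Y : Π p : M, TangentSpace I p} (hX : MDiffAt (T% X) p)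
    (hY : MDiffAt (T% Y) p) :
    mlieBracket I X Y p = leviCivita g Y p (X p) - leviCivita g X p (Y p) := by
  have h := (leviCivita g).torsion_apply hX hY
  rw [leviCivita_torsion] at h
  exact (sub_eq_zero.1 (h.symm.trans (by simp))).symm

/-- If `𝓛_V g = g` and `∇V` is self-adjoint, then `∇V = 1/2`. -/
lemma leviCivita_eq_half (hV : MDiffAt (T% V) p) (hg : IsLinearMetric g V 1)
    (hsa : IsSelfAdjointFor g (leviCivita g V)) (v : TangentSpace I p) :
    leviCivita g V p v = (1 / 2 : ℝ) • v := by
  apply ext_inner g p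
  intro w
  obtain ⟨X, hX, rfl⟩ := exists_ext v
  obtain ⟨Y, hY, rfl⟩ := exists_ext w
  have h1 := hg X Y p hX hY
  rw [lieDerivMetric, mlieBracket_eq_leviCivita g hV hX, mlieBracket_eq_leviCivita g hV hY,
    leviCivita_metric g hV hX hY] at h1
  have h2 := hsa p (X p) (Y p)
  simp only [map_sub, sub_apply, map_smul, smul_apply, smul_eq_mul] at h1 ⊢
  linarith

lemma divergence_of_eq_half (h : ∀ v, leviCivita g V p v = (1 / 2 : ℝ) • v) :
    divergence g V p = (Module.finrank ℝ E : ℝ) / 2 := by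
  have : FiniteDimensional ℝ (TangentSpace I p) := inferInstanceAs (FiniteDimensional ℝ E)
  have h1 : (leviCivita g V p : TangentSpace I p →ₗ[ℝ] TangentSpace I p) =
      (1 / 2 : ℝ) • LinearMap.id := by
    ext v
    exact h v
  rw [divergence, h1, map_smul, LinearMap.trace_id, smul_eq_mul]
  change (1 / 2 : ℝ) * (Module.finrank ℝ E : ℝ) = _
  ring

variable [I.Boundaryless]

lemma hess_apply_eq_half_grad (hV : MDiffAt (T% V) p) (hg : IsLinearMetric g V 1)
    (hsa : IsSelfAdjointFor g (leviCivita g V)) (hf : ContMDiff I 𝓘(ℝ) ∞ f)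
    (hVf : ∀ p, mvfderiv I f p (V p) = f p) :
    hess g f p (V p) = (1 / 2 : ℝ) • grad g f p := by
  apply ext_inner g p
  intro w
  obtain ⟨X, hX, rfl⟩ := exists_ext w
  have h0 : pairing g (grad g f) V = f := by
    funext q
    rw [pairing, inner_grad, hVf]
  have h1 := leviCivita_metric g hX (mdifferentiableAt_grad g hf) hV
  rw [h0, leviCivita_eq_half g hV hg hsa, ← inner_grad g] at h1
  rw [hess_symm g hf, g.symm, hess]
  simp only [map_smul, smul_apply, smul_eq_mul] at h1 ⊢
  linarith

/-- Pairings of gradients of `V`-linear functions are `V`-linear. -/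
lemma mvfderiv_pairing_grad (hV : MDiffAt (T% V) p) (hg : IsLinearMetric g V 1)
    (hsa : IsSelfAdjointFor g (leviCivita g V)) (hf : ContMDiff I 𝓘(ℝ) ∞ f)
    (hVf : ∀ p, mvfderiv I f p (V p) = f p) (hu : ContMDiff I 𝓘(ℝ) ∞ u)
    (hVu : ∀ p, mvfderiv I u p (V p) = u p) :
    mvfderiv I (pairing g (grad g f) (grad g u)) p (V p) =
      pairing g (grad g f) (grad g u) p := by
  have h1 := leviCivita_metric g hV (mdifferentiableAt_grad g hf) (mdifferentiableAt_grad g hu)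
  have h2 := hess_apply_eq_half_grad g hV hg hsa hf hVf
  have h3 := hess_apply_eq_half_grad g hV hg hsa hu hVu
  rw [hess] at h2 h3
  rw [h1, h2, h3, pairing]
  simp only [map_smul, smul_apply, smul_eq_mul]
  ring

omit [I.Boundaryless] in
lemma laplacian_nonneg (hpsd : HasPosSemidefHessian g f) :
    0 ≤ laplacian g f p := by
  have : FiniteDimensional ℝ (TangentSpace I p) := inferInstanceAs (FiniteDimensional ℝ E)
  obtain ⟨e, he⟩ := exists_orthonormal_basis (W := TangentSpace I p)
    (LinearMap.mk₂ ℝ (fun v w ↦ g.inner p v w) (by simp) (by simp) (by simp) (by simp))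
    (g.symm p) (g.pos p)
  rw [laplacian, LinearMap.trace_eq_matrix_trace ℝ e, Matrix.trace]
  refine Finset.sum_nonneg fun i _ ↦ ?_
  rw [Matrix.diag_apply, LinearMap.toMatrix_apply, he]
  exact hpsd p (e i)

/-- The gradient estimate `|∇f|² ≤ 2 f Δf` for convex `V`-linear functions. -/
lemma pairing_grad_self_le (hV : MDiffAt (T% V) p) (hg : IsLinearMetric g V 1)
    (hsa : IsSelfAdjointFor g (leviCivita g V)) (hf : ContMDiff I 𝓘(ℝ) ∞ f)
    (hVf : ∀ p, mvfderiv I f p (V p) = f p) (hpsd : HasPosSemidefHessian g f) :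
    pairing g (grad g f) (grad g f) p ≤ 2 * f p * laplacian g f p := by
  have : FiniteDimensional ℝ (TangentSpace I p) := inferInstanceAs (FiniteDimensional ℝ E)
  have h := apply_sq_le_trace_mul (W := TangentSpace I p)
    (LinearMap.mk₂ ℝ (fun v w ↦ g.inner p v w) (by simp) (by simp) (by simp) (by simp))
    (g.symm p) (g.pos p) (hess g f p).toLinearMap (hess_symm g hf) (hpsd p) (V p)
  have h2 := hess_apply_eq_half_grad g hV hg hsa hf hVf
  have h3 : g.inner p (grad g f p) (V p) = f p := by rw [inner_grad, hVf]
  have h4 : g.inner p (hess g f p (V p)) (hess g f p (V p)) ≤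
    laplacian g f p * g.inner p (hess g f p (V p)) (V p) := h
  rw [h2] at h4
  simp only [map_smul, smul_apply, smul_eq_mul, h3] at h4
  rw [pairing]
  linarith

end Cone

section Cylinder

variable {d m : ℕ} {M : Type*} [TopologicalSpace M] [ChartedSpace (EuclideanSpace ℝ (Fin d)) M]
  {Y : Type*} [TopologicalSpace Y] [ChartedSpace (EuclideanSpace ℝ (Fin m)) Y]
  {V : Π x : M, TangentSpace (𝓡 d) x} {ι : Y → M} {F : M → ℝ}

/-- Along an integral curve of `V`, a `V`-linear function grows exponentially. -/
lemma IsPositiveLinear.comp_integralCurve [IsManifold (𝓡 d) ∞ M] (hF : IsPositiveLinear V F)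
    {γ : ℝ → M} (hγ : IsMIntegralCurve γ V) (t : ℝ) : F (γ t) = Real.exp t * F (γ 0) := by
  have h1 : ∀ t, HasDerivAt (fun t ↦ F (γ t)) (F (γ t)) t := fun t ↦ by
    have h := (hF.smooth.mdifferentiableAt (by simp) (x := γ t)).hasMFDerivAt.comp t (hγ t)
    let A : ℝ →L[ℝ] ℝ := (mvfderiv (𝓡 d) F (γ t)).comp ((1 : ℝ →L[ℝ] ℝ).smulRight (V (γ t)))
    have h2 : HasFDerivAt (fun t ↦ F (γ t)) A t := h.hasFDerivAt
    have h3 : A 1 = F (γ t) := by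
      rw [← hF.linear (γ t)]
      simp [A]
    rw [← h3]
    exact h2.hasDerivAt
  have h2 : ∀ t, HasDerivAt (fun t ↦ Real.exp (-t) * F (γ t)) 0 t := fun t ↦ by
    convert! ((hasDerivAt_neg t).exp).mul (h1 t) using 1
    ring
  have h3 := is_const_of_deriv_eq_zero (fun t ↦ (h2 t).differentiableAt) (fun t ↦ (h2 t).deriv) t 0
  simp only [neg_zero, Real.exp_zero, one_mul] at h3
  rw [← h3, ← mul_assoc, ← Real.exp_add]
  simp

/-- The slabs `{a ≤ F ≤ b}` are compact. -/
lemma IsPositiveLinear.isCompact_slab [IsManifold (𝓡 d) ∞ M] [CompactSpace Y]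
    (hF : IsPositiveLinear V F) (hc : IsCylindrical m V ι) {a b : ℝ} (ha : 0 < a) :
    IsCompact {p | a ≤ F p ∧ F p ≤ b} := by
  obtain ⟨Φ, hΦ⟩ := hc.flow
  have hι : Continuous ι := by
    have : ι = fun y ↦ Φ (0, y) := funext fun y ↦ ((hΦ y).1).symm
    rw [this]
    exact Φ.continuous.comp (by fun_prop)
  have hFι : Continuous (fun y ↦ F (ι y)) := hF.smooth.continuous.comp hι
  obtain ⟨C, hC⟩ := isCompact_univ.exists_bound_of_continuousOn hFι.continuousOn
  obtain ⟨C', hC'⟩ := isCompact_univ.exists_bound_of_continuousOn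
    (hFι.inv₀ fun y ↦ (hF.pos _).ne').continuousOn
  set D := max C 1
  set D' := max C' 1
  have hD : 0 < D := lt_max_of_lt_right one_pos
  have hD' : 0 < D' := lt_max_of_lt_right one_pos
  have hK : IsCompact (Φ '' (Set.Icc (Real.log (a / D)) (Real.log (b * D')) ×ˢ Set.univ)) :=
    (isCompact_Icc.prod isCompact_univ).image Φ.continuous
  have hclosed : IsClosed {p | a ≤ F p ∧ F p ≤ b} :=
    (isClosed_le continuous_const hF.smooth.continuous).inter
      (isClosed_le hF.smooth.continuous continuous_const)
  refine hK.of_isClosed_subset hclosed fun p hp ↦ ?_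
  obtain ⟨⟨t, y⟩, hp'⟩ := Φ.surjective p
  refine ⟨(t, y), ⟨?_, Set.mem_univ _⟩, hp'⟩
  have hFp : F p = Real.exp t * F (ι y) := by
    rw [← hp', ← (hΦ y).1]
    exact hF.comp_integralCurve (hΦ y).2 t
  have hpos := hF.pos (ι y)
  have h1 : F (ι y) ≤ D := ((le_abs_self _).trans (hC y trivial)).trans (le_max_left _ _)
  have h2 : (F (ι y))⁻¹ ≤ D' := ((le_abs_self _).trans (hC' y trivial)).trans (le_max_left _ _)
  obtain ⟨hp1, hp2⟩ := hp
  rw [hFp] at hp1 hp2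
  have hb : Real.exp t ≤ b * D' := by
    have h3 : Real.exp t ≤ b * (F (ι y))⁻¹ := by rwa [← div_eq_mul_inv, le_div_iff₀ hpos]
    have hb0 : 0 ≤ b := (by positivity : (0 : ℝ) ≤ Real.exp t * F (ι y)).trans hp2
    exact h3.trans (mul_le_mul_of_nonneg_left h2 hb0)
  constructor
  · rw [Real.log_le_iff_le_exp (by positivity), div_le_iff₀ hD]
    exact hp1.trans (mul_le_mul_of_nonneg_left h1 (Real.exp_pos t).le)
  · rwa [Real.le_log_iff_exp_le ((Real.exp_pos t).trans_le hb)]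

/-- A vector field `V` with `𝓛_V g = g` and `∇V` self-adjoint, such that slabs of positive
`V`-linear functions are compact. -/
structure IsProperCone [IsManifold (𝓡 d) ∞ M] (g : SmoothMetric (𝓡 d) M)
    (V : Π x : M, TangentSpace (𝓡 d) x) : Prop where
  smooth : ContMDiff (𝓡 d) ((𝓡 d).prod 𝓘(ℝ, EuclideanSpace ℝ (Fin d))) ∞
    (fun x ↦ (⟨x, V x⟩ : TangentBundle (𝓡 d) M))
  linear : IsLinearMetric g V 1
  selfAdjoint : IsSelfAdjointFor g (leviCivita g V)
  proper : ∀ F, IsPositiveLinear V F → ∀ a b, 0 < a → IsCompact {p | a ≤ F p ∧ F p ≤ b}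

end Cylinder

section IntegrationByParts

variable {d : ℕ} {M : Type*} [TopologicalSpace M] [ChartedSpace (EuclideanSpace ℝ (Fin d)) M]
  [IsManifold (𝓡 d) ∞ M] {g : SmoothMetric (𝓡 d) M} {V : Π x : M, TangentSpace (𝓡 d) x}
  {F G u w : M → ℝ} {θ : ℝ → ℝ} {a b : ℝ} {p : M}

lemma deriv_eq_zero_of_notMem_Icc (hθ : ∀ s ∉ Set.Icc a b, θ s = 0) {s : ℝ}
    (hs : s ∉ Set.Icc a b) : deriv θ s = 0 := by
  have : θ =ᶠ[nhds s] fun _ ↦ 0 := by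
    filter_upwards [isClosed_Icc.isOpen_compl.mem_nhds hs] with r hr
    exact hθ r hr
  rw [this.deriv_eq, deriv_const]

lemma mvfderiv_comp_left (hθ : DifferentiableAt ℝ θ (F p))
    (hF : MDifferentiableAt (𝓡 d) 𝓘(ℝ) F p) (v : TangentSpace (𝓡 d) p) :
    mvfderiv (𝓡 d) (fun q ↦ θ (F q)) p v = deriv θ (F p) * mvfderiv (𝓡 d) F p v := by
  have h := (hθ.hasFDerivAt.hasMFDerivAt.comp p hF.hasMFDerivAt).mfderiv
  have h2 : mvfderiv (𝓡 d) (fun q ↦ θ (F q)) p v = fderiv ℝ θ (F p) (mvfderiv (𝓡 d) F p v) :=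
    congrArg (fun A : EuclideanSpace ℝ (Fin d) →L[ℝ] ℝ ↦ A v) h
  rw [h2, ← mul_one (mvfderiv (𝓡 d) F p v), ← smul_eq_mul, map_smul, smul_eq_mul, mul_comm]
  simp

lemma continuous_laplacian (hF : ContMDiff (𝓡 d) 𝓘(ℝ) ∞ F) : Continuous (laplacian g F) :=
  continuous_divergence g (contMDiff_grad g hF)

lemma contMDiff_pairing_grad (hF : ContMDiff (𝓡 d) 𝓘(ℝ) ∞ F) (hu : ContMDiff (𝓡 d) 𝓘(ℝ) ∞ u) :
    ContMDiff (𝓡 d) 𝓘(ℝ) ∞ (pairing g (grad g F) (grad g u)) := fun p ↦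
  contMDiffAt_pairing (n := ⊤) g (contMDiff_grad g hF p) (contMDiff_grad g hu p)

variable [MeasurableSpace M] [BorelSpace M] [T2Space M]

lemma integrable_of_continuous_of_isCompact {φ : M → ℝ} (hφ : Continuous φ) {K : Set M}
    (hK : IsCompact K) (h : ∀ p ∉ K, φ p = 0) : Integrable φ (riemannianVolume g) :=
  hφ.integrable_of_hasCompactSupport (HasCompactSupport.intro hK h)

variable [SecondCountableTopology M]

lemma integral_mul_divergence_add {h : M → ℝ} (hh : ContMDiff (𝓡 d) 𝓘(ℝ) ∞ h)
    {X : Π p : M, TangentSpace (𝓡 d) p}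
    (hX : ContMDiff (𝓡 d) ((𝓡 d).prod 𝓘(ℝ, EuclideanSpace ℝ (Fin d))) ∞
      (fun p ↦ (⟨p, X p⟩ : TangentBundle (𝓡 d) M))) {K : Set M} (hK : IsCompact K)
    (hhK : ∀ p ∉ K, h p = 0) :
    ∫ p, (h p * divergence g X p + mvfderiv (𝓡 d) h p (X p)) ∂(riemannianVolume g) = 0 := by
  rw [← integral_divergence_eq_zero g (X := h • X) (hh.smul_section hX) hK
    fun p hp ↦ by simp [hhK p hp]]
  refine integral_congr_ae (Filter.Eventually.of_forall fun p ↦ ?_)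
  exact (divergence_smul g (hX.mdifferentiableAt (by simp)) (hh.mdifferentiableAt (by simp))).symm

variable (hc : IsProperCone g V) (hF : IsPositiveLinear V F)
include hc hF

lemma IsProperCone.integrable_slab {φ : M → ℝ} (hφ : Continuous φ) (ha : 0 < a)
    (h : ∀ p, F p ∉ Set.Icc a b → φ p = 0) : Integrable φ (riemannianVolume g) :=
  integrable_of_continuous_of_isCompact hφ (hc.proper F hF a b ha) fun p hp ↦ h p hp

/-- The scaling identity for `V`-invariant weights. -/
lemma IsProperCone.integral_deriv_mul (hw : ContMDiff (𝓡 d) 𝓘(ℝ) ∞ w)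
    (hVw : ∀ p, mvfderiv (𝓡 d) w p (V p) = 0) (hθ : ContDiff ℝ ∞ θ) (ha : 0 < a)
    (hθ0 : ∀ s ∉ Set.Icc a b, θ s = 0) :
    ∫ p, deriv θ (F p) * F p * w p ∂(riemannianVolume g) =
      -((d : ℝ) / 2) * ∫ p, θ (F p) * w p ∂(riemannianVolume g) := by
  have hθF : ContMDiff (𝓡 d) 𝓘(ℝ) ∞ (fun p ↦ θ (F p)) := hθ.contMDiff.comp hF.smooth
  have h1 := integral_mul_divergence_add (g := g) (hθF.mul hw) hc.smooth
    (hc.proper F hF a b ha) fun p hp ↦ by simp [hθ0 (F p) hp]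
  have hcθ' : Continuous (deriv θ) := hθ.continuous_deriv (by simp)
  have hFc := hF.smooth.continuous
  have hwc := hw.continuous
  have hθc := hθ.continuous
  have h2 : Integrable (fun p ↦ deriv θ (F p) * F p * w p) (riemannianVolume g) :=
    hc.integrable_slab (b := b) hF (by fun_prop) ha fun p hp ↦ by
      simp [deriv_eq_zero_of_notMem_Icc hθ0 hp]
  have h3 : Integrable (fun p ↦ θ (F p) * w p) (riemannianVolume g) :=
    hc.integrable_slab (b := b) hF (by fun_prop) ha fun p hp ↦ by simp [hθ0 _ hp]
  have h4 : ∀ p, (θ (F p) * w p) * divergence g V p +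
      mvfderiv (𝓡 d) ((fun p ↦ θ (F p)) * w) p (V p) =
      (d : ℝ) / 2 * (θ (F p) * w p) + deriv θ (F p) * F p * w p := fun p ↦ by
    rw [divergence_of_eq_half g fun v ↦ leviCivita_eq_half g
      (hc.smooth.mdifferentiableAt (by simp)) hc.linear hc.selfAdjoint v,
      mvfderiv_mul (hθF.mdifferentiableAt (by simp)) (hw.mdifferentiableAt (by simp))]
    simp only [add_apply, smul_apply, smul_eq_mul, hVw, finrank_euclideanSpace, Fintype.card_fin]
    rw [mvfderiv_comp_left (hθ.differentiable (by simp) _) (hF.smooth.mdifferentiableAt (by simp)),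
      hF.linear]
    ring
  have h5 : ∫ p, ((d : ℝ) / 2 * (θ (F p) * w p) + deriv θ (F p) * F p * w p)
      ∂(riemannianVolume g) = 0 := by
    rw [← h1]
    exact integral_congr_ae (Filter.Eventually.of_forall fun p ↦ (h4 p).symm)
  rw [integral_add (h3.const_mul _) h2, integral_const_mul] at h5
  linarith

/-- Integration by parts against the Laplacian. -/
lemma IsProperCone.integral_mul_laplacian (hw : ContMDiff (𝓡 d) 𝓘(ℝ) ∞ w)
    (hθ : ContDiff ℝ ∞ θ) (ha : 0 < a) (hθ0 : ∀ s ∉ Set.Icc a b, θ s = 0) :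
    ∫ p, θ (F p) * w p * laplacian g F p ∂(riemannianVolume g) =
      -(∫ p, deriv θ (F p) * pairing g (grad g F) (grad g F) p * w p ∂(riemannianVolume g)) -
      ∫ p, θ (F p) * pairing g (grad g F) (grad g w) p ∂(riemannianVolume g) := by
  have hθF : ContMDiff (𝓡 d) 𝓘(ℝ) ∞ (fun p ↦ θ (F p)) := hθ.contMDiff.comp hF.smooth
  have h1 := integral_mul_divergence_add (g := g) (hθF.mul hw) (contMDiff_grad g hF.smooth)
    (hc.proper F hF a b ha) fun p hp ↦ by simp [hθ0 (F p) hp]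
  have hcθ' : Continuous (deriv θ) := hθ.continuous_deriv (by simp)
  have hFc := hF.smooth.continuous
  have hwc := hw.continuous
  have hθc := hθ.continuous
  have hP := (contMDiff_pairing_grad (g := g) hF.smooth hF.smooth).continuous
  have hPw := (contMDiff_pairing_grad (g := g) hF.smooth hw).continuous
  have hL := continuous_laplacian (g := g) hF.smooth
  have h2 : Integrable (fun p ↦ deriv θ (F p) * pairing g (grad g F) (grad g F) p * w p)
      (riemannianVolume g) :=
    hc.integrable_slab (b := b) hF (by fun_prop) ha fun p hp ↦ by
      simp [deriv_eq_zero_of_notMem_Icc hθ0 hp]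
  have h3 : Integrable (fun p ↦ θ (F p) * pairing g (grad g F) (grad g w) p)
      (riemannianVolume g) :=
    hc.integrable_slab (b := b) hF (by fun_prop) ha fun p hp ↦ by simp [hθ0 _ hp]
  have h3' : Integrable (fun p ↦ θ (F p) * w p * laplacian g F p) (riemannianVolume g) :=
    hc.integrable_slab (b := b) hF (by fun_prop) ha fun p hp ↦ by simp [hθ0 _ hp]
  have h4 : ∀ p, (θ (F p) * w p) * divergence g (grad g F) p +
      mvfderiv (𝓡 d) ((fun p ↦ θ (F p)) * w) p (grad g F p) =
      θ (F p) * w p * laplacian g F p +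
      deriv θ (F p) * pairing g (grad g F) (grad g F) p * w p +
      θ (F p) * pairing g (grad g F) (grad g w) p := fun p ↦ by
    rw [mvfderiv_mul (hθF.mdifferentiableAt (by simp)) (hw.mdifferentiableAt (by simp)),
      ← laplacian_eq_divergence]
    simp only [add_apply, smul_apply, smul_eq_mul]
    rw [mvfderiv_comp_left (hθ.differentiable (by simp) _) (hF.smooth.mdifferentiableAt (by simp)),
      pairing_comm g (grad g F) (grad g w), pairing, pairing, inner_grad, inner_grad]
    ring
  have h5 : ∫ p, (θ (F p) * w p * laplacian g F p +
      deriv θ (F p) * pairing g (grad g F) (grad g F) p * w p +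
      θ (F p) * pairing g (grad g F) (grad g w) p) ∂(riemannianVolume g) = 0 := by
    rw [← h1]
    exact integral_congr_ae (Filter.Eventually.of_forall fun p ↦ (h4 p).symm)
  have h6 : Integrable (fun p ↦ θ (F p) * w p * laplacian g F p +
      deriv θ (F p) * pairing g (grad g F) (grad g F) p * w p) (riemannianVolume g) := h3'.add h2
  rw [integral_add h6 h3, integral_add h3' h2] at h5
  linarith

end IntegrationByParts

section DifferentialInequality

variable {d : ℕ} {M : Type*} [TopologicalSpace M] [ChartedSpace (EuclideanSpace ℝ (Fin d)) M]
  [IsManifold (𝓡 d) ∞ M] {g : SmoothMetric (𝓡 d) M} {V : Π x : M, TangentSpace (𝓡 d) x}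
  {F u P : M → ℝ} {χ : ℝ → ℝ} {a b c : ℝ} {p : M}

lemma ContMDiff.div_of_pos (hP : ContMDiff (𝓡 d) 𝓘(ℝ) ∞ P) (hF : ContMDiff (𝓡 d) 𝓘(ℝ) ∞ F)
    (h0 : ∀ p, 0 < F p) : ContMDiff (𝓡 d) 𝓘(ℝ) ∞ (fun p ↦ P p / F p) := fun p ↦ by
  have h1 : ContMDiffAt (𝓡 d) 𝓘(ℝ) ∞ (fun q ↦ (F q)⁻¹) p :=
    ((contDiffAt_inv ℝ (h0 p).ne').contMDiffAt (n := ∞)).comp p (hF p)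
  simpa only [div_eq_mul_inv] using! (hP p).mul h1

lemma mvfderiv_eq_of_div (hP : ContMDiff (𝓡 d) 𝓘(ℝ) ∞ P) (hF : ContMDiff (𝓡 d) 𝓘(ℝ) ∞ F)
    (h0 : ∀ p, 0 < F p) (v : TangentSpace (𝓡 d) p) :
    mvfderiv (𝓡 d) P p v = P p / F p * mvfderiv (𝓡 d) F p v +
      F p * mvfderiv (𝓡 d) (fun p ↦ P p / F p) p v := by
  have h1 : P = fun q ↦ P q / F q * F q := funext fun q ↦ (div_mul_cancel₀ _ (h0 q).ne').symm
  conv_lhs => rw [h1]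
  rw [mvfderiv_fun_mul ((ContMDiff.div_of_pos hP hF h0).mdifferentiableAt (by simp))
    (hF.mdifferentiableAt (by simp))]
  simp

lemma IsPositiveLinear.mvfderiv_div (hF : IsPositiveLinear V F)
    (hP : ContMDiff (𝓡 d) 𝓘(ℝ) ∞ P) (hVP : mvfderiv (𝓡 d) P p (V p) = P p) :
    mvfderiv (𝓡 d) (fun p ↦ P p / F p) p (V p) = 0 := by
  have h := mvfderiv_eq_of_div hP hF.smooth hF.pos (V p)
  have h0 := (hF.pos p).ne'
  rw [hVP, hF.linear, div_mul_cancel₀ _ h0] at h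
  have h2 : F p * mvfderiv (𝓡 d) (fun p ↦ P p / F p) p (V p) = 0 := by linarith
  exact (mul_eq_zero.1 h2).resolve_left h0

lemma pairing_grad_div (hu : ContMDiff (𝓡 d) 𝓘(ℝ) ∞ u) (hF : ContMDiff (𝓡 d) 𝓘(ℝ) ∞ F)
    (h0 : ∀ p, 0 < F p) :
    pairing g (grad g F) (grad g (fun p ↦ u p / F p)) p =
      pairing g (grad g F) (grad g u) p / F p -
        u p / F p * (pairing g (grad g F) (grad g F) p / F p) := by
  have h := mvfderiv_eq_of_div hu hF h0 (grad g F p)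
  have h1 := (h0 p).ne'
  rw [← inner_grad g, ← inner_grad g, ← inner_grad g] at h
  rw [pairing_comm g (grad g F) (grad g u), pairing_comm g (grad g F) (grad g fun p ↦ u p / F p)]
  simp only [pairing]
  rw [h]
  field_simp
  ring

lemma pairing_grad_one (X : Π p : M, TangentSpace (𝓡 d) p) :
    pairing g X (grad g (fun _ ↦ (1 : ℝ))) p = 0 := by
  rw [pairing_comm, pairing, inner_grad, mvfderiv_const]
  simp

variable [MeasurableSpace M] [BorelSpace M] [T2Space M] [SecondCountableTopology M]

variable (hc : IsProperCone g V) (hF : IsPositiveLinear V F) (hχ : ContDiff ℝ ∞ χ)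
  (ha : 0 < a) (hχ0 : ∀ s ∉ Set.Icc a b, χ s = 0)
include hc hF hχ ha hχ0

/-- The weighted integral of the Laplacian in terms of first derivatives. -/
lemma IsProperCone.integral_laplacian_eq :
    ∫ p, χ (F p) * laplacian g F p ∂(riemannianVolume g) = (d : ℝ) / 2 *
      ∫ p, χ (F p) * (pairing g (grad g F) (grad g F) p / F p) ∂(riemannianVolume g) := by
  have hP := contMDiff_pairing_grad (g := g) hF.smooth hF.smooth
  have h1 := hc.integral_mul_laplacian hF (w := fun _ ↦ 1) contMDiff_const hχ ha hχ0
  have h2 := hc.integral_deriv_mul hF (ContMDiff.div_of_pos hP hF.smooth hF.pos)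
    (fun p ↦ hF.mvfderiv_div hP (mvfderiv_pairing_grad g (hc.smooth.mdifferentiableAt (by simp))
      hc.linear hc.selfAdjoint hF.smooth hF.linear hF.smooth hF.linear)) hχ ha hχ0
  simp only [mul_one, pairing_grad_one, mul_zero, integral_zero, sub_zero] at h1
  have h3 : ∀ p, deriv χ (F p) * F p * (pairing g (grad g F) (grad g F) p / F p) =
      deriv χ (F p) * pairing g (grad g F) (grad g F) p := fun p ↦ by
    have := (hF.pos p).ne'
    field_simp
  simp only [h3] at h2
  rw [h1, h2]
  ring

/-- The differential inequality along a linear path of convex `V`-linear functions. -/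
lemma IsProperCone.integral_variation_le (hχn : ∀ s, 0 ≤ χ s) (hpsd : HasPosSemidefHessian g F)
    (hu : ContMDiff (𝓡 d) 𝓘(ℝ) ∞ u) (hVu : ∀ p, mvfderiv (𝓡 d) u p (V p) = u p)
    (hu0 : ∀ p, 0 ≤ u p) (huc : ∀ p, u p ≤ c * F p) :
    ∫ p, (deriv χ (F p) * F p * (u p / F p * (pairing g (grad g F) (grad g F) p / F p)) +
      χ (F p) * (2 * (pairing g (grad g F) (grad g u) p / F p) -
        u p / F p * (pairing g (grad g F) (grad g F) p / F p))) ∂(riemannianVolume g) ≤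
      c * (d : ℝ) ^ 2 / 2 *
        ∫ p, χ (F p) * (pairing g (grad g F) (grad g F) p / F p) ∂(riemannianVolume g) := by
  have hVm : ∀ p, MDifferentiableAt (𝓡 d) ((𝓡 d).prod 𝓘(ℝ, EuclideanSpace ℝ (Fin d)))
      (fun x ↦ (⟨x, V x⟩ : TangentBundle (𝓡 d) M)) p := fun p ↦
    hc.smooth.mdifferentiableAt (by simp)
  have hPs := contMDiff_pairing_grad (g := g) hF.smooth hF.smooth
  have hQs := contMDiff_pairing_grad (g := g) hF.smooth hu
  have huF := ContMDiff.div_of_pos hu hF.smooth hF.pos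
  have hPF := ContMDiff.div_of_pos hPs hF.smooth hF.pos
  have hQF := ContMDiff.div_of_pos hQs hF.smooth hF.pos
  have hχc := hχ.continuous
  have hχc' : Continuous (deriv χ) := hχ.continuous_deriv (by simp)
  have hFc := hF.smooth.continuous
  have huFc := huF.continuous
  have hPFc := hPF.continuous
  have hQFc := hQF.continuous
  have hLc := continuous_laplacian (g := g) hF.smooth
  set q : M → ℝ := fun p ↦ u p / F p with hq
  set P : M → ℝ := fun p ↦ pairing g (grad g F) (grad g F) p / F p with hP
  set Q : M → ℝ := fun p ↦ pairing g (grad g F) (grad g u) p / F p with hQ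
  set Λ := laplacian g F with hΛ
  have hI : ∀ {φ : M → ℝ}, Continuous φ → (∀ p, F p ∉ Set.Icc a b → φ p = 0) →
      Integrable φ (riemannianVolume g) := fun h1 h2 ↦ hc.integrable_slab (b := b) hF h1 ha h2
  have iA : Integrable (fun p ↦ deriv χ (F p) * F p * (q p * P p)) (riemannianVolume g) :=
    hI (by fun_prop) fun p hp ↦ by simp [deriv_eq_zero_of_notMem_Icc hχ0 hp]
  have iB : Integrable (fun p ↦ χ (F p) * (q p * P p)) (riemannianVolume g) :=
    hI (by fun_prop) fun p hp ↦ by simp [hχ0 _ hp]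
  have iD : Integrable (fun p ↦ χ (F p) * Q p) (riemannianVolume g) :=
    hI (by fun_prop) fun p hp ↦ by simp [hχ0 _ hp]
  have iJ : Integrable (fun p ↦ χ (F p) * q p * Λ p) (riemannianVolume g) :=
    hI (by fun_prop) fun p hp ↦ by simp [hχ0 _ hp]
  have iS : Integrable (fun p ↦ χ (F p) * Λ p) (riemannianVolume g) :=
    hI (by fun_prop) fun p hp ↦ by simp [hχ0 _ hp]
  have hVP : ∀ p, mvfderiv (𝓡 d) P p (V p) = 0 := fun p ↦ hF.mvfderiv_div hPs
    (mvfderiv_pairing_grad g (hVm p) hc.linear hc.selfAdjoint hF.smooth hF.linear hF.smooth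
      hF.linear)
  have hVq : ∀ p, mvfderiv (𝓡 d) q p (V p) = 0 := fun p ↦ hF.mvfderiv_div hu (hVu p)
  have hA := hc.integral_deriv_mul hF (huF.mul hPF) (fun p ↦ by
    rw [mvfderiv_mul (huF.mdifferentiableAt (by simp)) (hPF.mdifferentiableAt (by simp))]
    simp only [add_apply, smul_apply, smul_eq_mul]
    rw [hVP, hVq]
    simp) hχ ha hχ0
  have hJ := hc.integral_mul_laplacian hF huF hχ ha hχ0
  have hS := hc.integral_laplacian_eq hF hχ ha hχ0
  have e1 : ∀ p, deriv χ (F p) * pairing g (grad g F) (grad g F) p * q p =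
      deriv χ (F p) * F p * (q p * P p) := fun p ↦ by
    have := (hF.pos p).ne'
    simp only [hq, hP]
    field_simp
  have e2 : ∀ p, χ (F p) * pairing g (grad g F) (grad g q) p =
      χ (F p) * Q p - χ (F p) * (q p * P p) := fun p ↦ by
    rw [pairing_grad_div hu hF.smooth hF.pos]
    ring
  simp only [e1, e2] at hJ
  rw [integral_sub iD iB] at hJ
  have hA' : ∫ p, deriv χ (F p) * F p * (q p * P p) ∂(riemannianVolume g) =
      -((d : ℝ) / 2) * ∫ p, χ (F p) * (q p * P p) ∂(riemannianVolume g) := hA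
  have hsplit : ∫ p, (deriv χ (F p) * F p * (q p * P p) + χ (F p) * (2 * Q p - q p * P p))
      ∂(riemannianVolume g) = ∫ p, deriv χ (F p) * F p * (q p * P p) ∂(riemannianVolume g) +
      (2 * ∫ p, χ (F p) * Q p ∂(riemannianVolume g) -
        ∫ p, χ (F p) * (q p * P p) ∂(riemannianVolume g)) := by
    have h1 : Integrable (fun p ↦ 2 * (χ (F p) * Q p) - χ (F p) * (q p * P p))
      (riemannianVolume g) := (iD.const_mul 2).sub iB
    rw [← integral_const_mul, ← integral_sub (iD.const_mul 2) iB, ← integral_add iA h1]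
    exact integral_congr_ae (Filter.Eventually.of_forall fun p ↦ by ring)
  have hBJ : ∫ p, χ (F p) * (q p * P p) ∂(riemannianVolume g) ≤
      2 * ∫ p, χ (F p) * q p * Λ p ∂(riemannianVolume g) := by
    rw [← integral_const_mul]
    refine integral_mono iB (iJ.const_mul 2) fun p ↦ ?_
    have h1 : P p ≤ 2 * Λ p := by
      have := pairing_grad_self_le g (hVm p) hc.linear hc.selfAdjoint hF.smooth hF.linear hpsd
      rw [hP]
      simp only
      rw [div_le_iff₀ (hF.pos p)]
      linarith
    have h2 : 0 ≤ χ (F p) * q p := mul_nonneg (hχn _) (div_nonneg (hu0 p) (hF.pos p).le)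
    have h3 := mul_le_mul_of_nonneg_left h1 h2
    simp only
    linarith
  have hJS : ∫ p, χ (F p) * q p * Λ p ∂(riemannianVolume g) ≤
      c * ∫ p, χ (F p) * Λ p ∂(riemannianVolume g) := by
    rw [← integral_const_mul]
    refine integral_mono iJ (iS.const_mul c) fun p ↦ ?_
    have h1 : q p ≤ c := (div_le_iff₀ (hF.pos p)).2 (huc p)
    have h2 : 0 ≤ χ (F p) * Λ p := mul_nonneg (hχn _) (laplacian_nonneg g hpsd)
    have h3 := mul_le_mul_of_nonneg_right h1 h2
    simp only
    linarith
  rw [hS] at hJS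
  have hd : (0 : ℝ) ≤ d := Nat.cast_nonneg d
  change ∫ p, (deriv χ (F p) * F p * (q p * P p) + χ (F p) * (2 * Q p - q p * P p))
      ∂(riemannianVolume g) ≤ _
  rw [hsplit]
  change _ = -_ - _ at hJ
  change _ ≤ c * (d : ℝ) ^ 2 / 2 * ∫ p, χ (F p) * P p ∂(riemannianVolume g)
  change _ ≤ c * ((d : ℝ) / 2 * ∫ p, χ (F p) * P p ∂(riemannianVolume g)) at hJS
  generalize (∫ p, χ (F p) * P p ∂(riemannianVolume g)) = Φ at *
  generalize (∫ p, χ (F p) * (q p * P p) ∂(riemannianVolume g)) = B at *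
  generalize (∫ p, χ (F p) * Q p ∂(riemannianVolume g)) = D at *
  generalize (∫ p, χ (F p) * q p * Λ p ∂(riemannianVolume g)) = J at *
  have k1 := mul_le_mul_of_nonneg_left hBJ (by positivity : (0 : ℝ) ≤ (d : ℝ) / 2 + 1)
  have k2 := mul_le_mul_of_nonneg_left hJS hd
  rw [hA'] at hJ ⊢
  nlinarith

end DifferentialInequality

section LinearCombination

variable {d : ℕ} {M : Type*} [TopologicalSpace M] [ChartedSpace (EuclideanSpace ℝ (Fin d)) M]
  [IsManifold (𝓡 d) ∞ M] {g : SmoothMetric (𝓡 d) M} {V : Π x : M, TangentSpace (𝓡 d) x}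
  {G H : M → ℝ} {p : M}

lemma mvfderiv_linearCombination (hG : ContMDiff (𝓡 d) 𝓘(ℝ) ∞ G)
    (hH : ContMDiff (𝓡 d) 𝓘(ℝ) ∞ H) (a b : ℝ) (v : TangentSpace (𝓡 d) p) :
    mvfderiv (𝓡 d) (fun p ↦ a * G p + b * H p) p v =
      a * mvfderiv (𝓡 d) G p v + b * mvfderiv (𝓡 d) H p v := by
  have hG' := hG.mdifferentiableAt (x := p) (by simp)
  have hH' := hH.mdifferentiableAt (x := p) (by simp)
  have ha : MDifferentiableAt (𝓡 d) 𝓘(ℝ) (fun _ : M ↦ a) p := mdifferentiableAt_const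
  have hb : MDifferentiableAt (𝓡 d) 𝓘(ℝ) (fun _ : M ↦ b) p := mdifferentiableAt_const
  have h1 : MDifferentiableAt (𝓡 d) 𝓘(ℝ) (fun p ↦ a * G p) p := ha.mul hG'
  have h2 : MDifferentiableAt (𝓡 d) 𝓘(ℝ) (fun p ↦ b * H p) p := hb.mul hH'
  rw [mvfderiv_fun_add h1 h2, mvfderiv_fun_mul ha hG', mvfderiv_fun_mul hb hH', mvfderiv_const,
    mvfderiv_const]
  simp

lemma contMDiff_linearCombination (hG : ContMDiff (𝓡 d) 𝓘(ℝ) ∞ G)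
    (hH : ContMDiff (𝓡 d) 𝓘(ℝ) ∞ H) (a b : ℝ) :
    ContMDiff (𝓡 d) 𝓘(ℝ) ∞ (fun p ↦ a * G p + b * H p) :=
  (contMDiff_const.mul hG).add (contMDiff_const.mul hH)

lemma grad_linearCombination (hG : ContMDiff (𝓡 d) 𝓘(ℝ) ∞ G)
    (hH : ContMDiff (𝓡 d) 𝓘(ℝ) ∞ H) (a b : ℝ) :
    grad g (fun p ↦ a * G p + b * H p) = a • grad g G + b • grad g H := by
  funext p
  apply ext_inner g p
  intro w
  rw [inner_grad, mvfderiv_linearCombination hG hH]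
  simp [inner_grad]

lemma hess_linearCombination (hG : ContMDiff (𝓡 d) 𝓘(ℝ) ∞ G)
    (hH : ContMDiff (𝓡 d) 𝓘(ℝ) ∞ H) (a b : ℝ) :
    hess g (fun p ↦ a * G p + b * H p) p = a • hess g G p + b • hess g H p := by
  have h1 : ∀ (c : ℝ) {f : M → ℝ}, ContMDiff (𝓡 d) 𝓘(ℝ) ∞ f →
      MDifferentiableAt (𝓡 d) ((𝓡 d).prod 𝓘(ℝ, EuclideanSpace ℝ (Fin d)))
        (fun p ↦ (⟨p, (c • grad g f) p⟩ : TangentBundle (𝓡 d) M)) p ∧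
      leviCivita g (c • grad g f) p = c • hess g f p := fun c f hf ↦ by
    have hc : ContMDiff (𝓡 d) 𝓘(ℝ) ∞ (fun _ : M ↦ c) := contMDiff_const
    refine ⟨(hc.smul_section (contMDiff_grad g hf)).mdifferentiableAt (by simp), ?_⟩
    have h2 := leviCivita_smul (f := fun _ ↦ c) g (mdifferentiableAt_grad (p := p) g hf)
      (hc.mdifferentiableAt (by simp))
    refine h2.trans ?_
    rw [mvfderiv_const]
    ext v
    simp [hess]
  rw [hess, grad_linearCombination hG hH, leviCivita_add g (h1 a hG).1 (h1 b hH).1, (h1 a hG).2,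
    (h1 b hH).2]

lemma HasPosSemidefHessian.linearCombination (hG : ContMDiff (𝓡 d) 𝓘(ℝ) ∞ G)
    (hH : ContMDiff (𝓡 d) 𝓘(ℝ) ∞ H) (hGp : HasPosSemidefHessian g G)
    (hHp : HasPosSemidefHessian g H) {a b : ℝ} (ha : 0 ≤ a) (hb : 0 ≤ b) :
    HasPosSemidefHessian g (fun p ↦ a * G p + b * H p) := fun p v ↦ by
  rw [hess_linearCombination hG hH]
  simp only [add_apply, smul_apply, map_add, map_smul, smul_eq_mul]
  exact add_nonneg (mul_nonneg ha (hGp p v)) (mul_nonneg hb (hHp p v))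

lemma IsPositiveLinear.linearCombination (hG : IsPositiveLinear V G) (hH : IsPositiveLinear V H)
    (a b : ℝ) (h0 : ∀ p, 0 < a * G p + b * H p) :
    IsPositiveLinear V (fun p ↦ a * G p + b * H p) where
  smooth := contMDiff_linearCombination hG.smooth hH.smooth a b
  linear p := by rw [mvfderiv_linearCombination hG.smooth hH.smooth, hG.linear, hH.linear]
  pos := h0

lemma pairing_self_nonneg (X : Π p : M, TangentSpace (𝓡 d) p) : 0 ≤ pairing g X X p := by
  by_cases h : X p = 0
  · simp [pairing, h]
  · exact (g.pos p _ h).le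

lemma pairing_grad_linearCombination (hG : ContMDiff (𝓡 d) 𝓘(ℝ) ∞ G)
    (hH : ContMDiff (𝓡 d) 𝓘(ℝ) ∞ H) (a b a' b' : ℝ) :
    pairing g (grad g (fun p ↦ a * G p + b * H p)) (grad g (fun p ↦ a' * G p + b' * H p)) p =
      a * a' * pairing g (grad g G) (grad g G) p +
      (a * b' + b * a') * pairing g (grad g G) (grad g H) p +
      b * b' * pairing g (grad g H) (grad g H) p := by
  rw [grad_linearCombination hG hH, grad_linearCombination hG hH]
  simp only [pairing, Pi.add_apply, Pi.smul_apply, map_add, map_smul, add_apply, smul_apply,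
    smul_eq_mul, g.symm p (grad g H p) (grad g G p)]
  ring

end LinearCombination

section Path

lemma hasDerivAt_setIntegral_of_isCompact {X : Type*} [TopologicalSpace X] [MeasurableSpace X]
    [BorelSpace X] [T2Space X] [SecondCountableTopology X] {μ : Measure X}
    [IsFiniteMeasureOnCompacts μ] {K : Set X} (hK : IsCompact K) {Ψ Ψ' : ℝ → X → ℝ} {t₀ ε : ℝ}
    (hε : 0 < ε) (hΨ : ∀ t ∈ Set.Icc (t₀ - ε) (t₀ + ε), ContinuousOn (Ψ t) K)
    (hΨ' : ContinuousOn (Function.uncurry Ψ') (Set.Icc (t₀ - ε) (t₀ + ε) ×ˢ K))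
    (hd : ∀ t ∈ Set.Icc (t₀ - ε) (t₀ + ε), ∀ x ∈ K, HasDerivAt (fun t ↦ Ψ t x) (Ψ' t x) t) :
    HasDerivAt (fun t ↦ ∫ x in K, Ψ t x ∂μ) (∫ x in K, Ψ' t₀ x ∂μ) t₀ := by
  have hs : Set.Icc (t₀ - ε) (t₀ + ε) ∈ nhds t₀ := Icc_mem_nhds (by linarith) (by linarith)
  have ht₀ := mem_of_mem_nhds hs
  obtain ⟨C, hC⟩ := (isCompact_Icc.prod hK).exists_bound_of_continuousOn hΨ'
  have hKm := hK.measurableSet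
  have h1 : ContinuousOn (Ψ' t₀) K :=
    hΨ'.comp (by fun_prop : ContinuousOn (fun x ↦ (t₀, x)) K) fun x hx ↦ ⟨ht₀, hx⟩
  refine (hasDerivAt_integral_of_dominated_loc_of_deriv_le (bound := fun _ ↦ C) hs ?_ ?_ ?_ ?_ ?_
    ?_).2
  · filter_upwards [hs] with t ht
    exact ((hΨ t ht).integrableOn_compact hK).aestronglyMeasurable
  · exact (hΨ t₀ ht₀).integrableOn_compact hK
  · exact (h1.integrableOn_compact hK).aestronglyMeasurable
  · exact (ae_restrict_iff' hKm).2 (.of_forall fun x hx t ht ↦ hC (t, x) ⟨ht, hx⟩)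
  · exact integrableOn_const hK.measure_lt_top.ne
  · exact (ae_restrict_iff' hKm).2 (.of_forall fun x hx t ht ↦ hd t ht x hx)

lemma le_exp_mul_of_hasDerivAt_le {f f' : ℝ → ℝ} {c : ℝ}
    (hf : ∀ t ∈ Set.Icc (0 : ℝ) 1, HasDerivAt f (f' t) t)
    (h : ∀ t ∈ Set.Icc (0 : ℝ) 1, f' t ≤ c * f t) : f 1 ≤ Real.exp c * f 0 := by
  have h1 : ∀ t ∈ Set.Icc (0 : ℝ) 1, HasDerivAt (fun t ↦ Real.exp (-c * t) * f t)
      (Real.exp (-c * t) * (f' t - c * f t)) t := fun t ht ↦ by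
    convert! (((hasDerivAt_id t).const_mul (-c)).exp).mul (hf t ht) using 1
    simp only [id]
    ring
  have h2 : AntitoneOn (fun t ↦ Real.exp (-c * t) * f t) (Set.Icc 0 1) := by
    refine antitoneOn_of_deriv_nonpos (convex_Icc 0 1)
      (fun t ht ↦ (h1 t ht).continuousAt.continuousWithinAt)
      (fun t ht ↦ (h1 t (interior_subset ht)).differentiableAt.differentiableWithinAt)
      fun t ht ↦ ?_
    rw [(h1 t (interior_subset ht)).deriv]
    exact mul_nonpos_of_nonneg_of_nonpos (Real.exp_pos _).le
      (sub_nonpos.2 (h t (interior_subset ht)))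
  have h3 := h2 (Set.left_mem_Icc.2 zero_le_one) (Set.right_mem_Icc.2 zero_le_one) zero_le_one
  simp only [mul_one, mul_zero, Real.exp_zero, one_mul, Real.exp_neg] at h3
  rwa [inv_mul_le_iff₀ (Real.exp_pos c)] at h3

variable {d : ℕ} {M : Type*} [TopologicalSpace M] [ChartedSpace (EuclideanSpace ℝ (Fin d)) M]
  [IsManifold (𝓡 d) ∞ M] {g : SmoothMetric (𝓡 d) M} {V : Π x : M, TangentSpace (𝓡 d) x}
  {G H : M → ℝ} {χ : ℝ → ℝ} {a b L : ℝ} [MeasurableSpace M] [BorelSpace M] [T2Space M]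
  [SecondCountableTopology M]

/-- The comparison of weighted integrals of Laplacians, for a smooth cutoff function. -/
lemma IsProperCone.integral_laplacian_le (hc : IsProperCone g V) (hG : IsPositiveLinear V G)
    (hH : IsPositiveLinear V H) (hGp : HasPosSemidefHessian g G) (hHp : HasPosSemidefHessian g H)
    (hL : 1 ≤ L) (hGH : ∀ p, G p ≤ H p) (hHG : ∀ p, H p ≤ L * G p) (hχ : ContDiff ℝ ∞ χ)
    (ha : 0 < a) (hχ0 : ∀ s ∉ Set.Icc a b, χ s = 0) (hχn : ∀ s, 0 ≤ χ s) :
    ∫ p, χ (H p) * laplacian g H p ∂(riemannianVolume g) ≤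
      Real.exp (L * (d : ℝ) ^ 2 / 2) *
        ∫ p, χ (G p) * laplacian g G p ∂(riemannianVolume g) := by
  let F : ℝ → M → ℝ := fun t p ↦ (1 - t) * G p + t * H p
  let u : M → ℝ := fun p ↦ (-1) * G p + 1 * H p
  let A := pairing g (grad g G) (grad g G)
  let B := pairing g (grad g G) (grad g H)
  let C := pairing g (grad g H) (grad g H)
  let P : ℝ → M → ℝ := fun t ↦ pairing g (grad g (F t)) (grad g (F t))
  let Q : ℝ → M → ℝ := fun t ↦ pairing g (grad g (F t)) (grad g u)
  have hPe : ∀ t p, P t p = (1 - t) * (1 - t) * A p + ((1 - t) * t + t * (1 - t)) * B p +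
      t * t * C p := fun t p ↦ pairing_grad_linearCombination hG.smooth hH.smooth _ _ _ _
  have hQe : ∀ t p, Q t p = (1 - t) * (-1) * A p + ((1 - t) * 1 + t * (-1)) * B p +
      t * 1 * C p := fun t p ↦ pairing_grad_linearCombination hG.smooth hH.smooth _ _ _ _
  have hAc : Continuous A := (contMDiff_pairing_grad hG.smooth hG.smooth).continuous
  have hBc : Continuous B := (contMDiff_pairing_grad hG.smooth hH.smooth).continuous
  have hCc : Continuous C := (contMDiff_pairing_grad hH.smooth hH.smooth).continuous
  have hGc := hG.smooth.continuous
  have hHc := hH.smooth.continuous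
  have hχc := hχ.continuous
  have hχc' : Continuous (deriv χ) := hχ.continuous_deriv (by simp)
  let Ψ : ℝ → M → ℝ := fun t p ↦ χ (F t p) * (P t p / F t p)
  let Ψ' : ℝ → M → ℝ := fun t p ↦ deriv χ (F t p) * F t p * (u p / F t p * (P t p / F t p)) +
    χ (F t p) * (2 * (Q t p / F t p) - u p / F t p * (P t p / F t p))
  set ε := 1 / (2 * L) with hε
  have hLpos : 0 < L := by linarith
  have hε0 : 0 < ε := by positivity
  have hε1 : ε ≤ 1 := by
    rw [hε, div_le_one (by positivity)]
    linarith
  have hεL : ε * L = 1 / 2 := by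
    rw [hε]
    field_simp
  have hlow : ∀ t p, -ε ≤ t → G p / 2 ≤ F t p := fun t p ht ↦ by
    have h1 := hGH p
    have h2 := hHG p
    have h3 := hG.pos p
    simp only [F]
    nlinarith [mul_nonneg (by linarith : 0 ≤ t + ε) (by linarith : 0 ≤ H p - G p),
      mul_nonneg hε0.le (by linarith : 0 ≤ L * G p - H p)]
  have hup : ∀ t p, t ≤ 1 + ε → F t p ≤ 2 * L * G p := fun t p ht ↦ by
    have h1 := hGH p
    have h2 := hHG p
    have h3 := hG.pos p
    simp only [F]
    nlinarith [mul_nonneg (by linarith : 0 ≤ 2 - t) (by linarith : 0 ≤ H p - G p)]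
  have hFpos : ∀ t p, -ε ≤ t → 0 < F t p := fun t p ht ↦
    (half_pos (hG.pos p)).trans_le (hlow t p ht)
  set K : Set M := {p | a / (2 * L) ≤ G p ∧ G p ≤ 2 * b} with hKdef
  have hK : IsCompact K := hc.proper G hG _ _ (by positivity)
  have hnotK : ∀ t p, -ε ≤ t → t ≤ 1 + ε → p ∉ K → F t p ∉ Set.Icc a b := fun t p h1 h2 hp h ↦ by
    refine hp ⟨?_, ?_⟩
    · rw [div_le_iff₀ (by positivity)]
      linarith [hup t p h2, h.1]
    · linarith [hlow t p h1, h.2]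
  have hKint : ∀ t, -ε ≤ t → t ≤ 1 + ε → ∫ p in K, Ψ t p ∂(riemannianVolume g) =
      ∫ p, Ψ t p ∂(riemannianVolume g) := fun t h1 h2 ↦
    setIntegral_eq_integral_of_forall_compl_eq_zero fun p hp ↦ by
      simp [Ψ, hχ0 _ (hnotK t p h1 h2 hp)]
  have hKint' : ∀ t, -ε ≤ t → t ≤ 1 + ε → ∫ p in K, Ψ' t p ∂(riemannianVolume g) =
      ∫ p, Ψ' t p ∂(riemannianVolume g) := fun t h1 h2 ↦
    setIntegral_eq_integral_of_forall_compl_eq_zero fun p hp ↦ by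
      simp [Ψ', hχ0 _ (hnotK t p h1 h2 hp), deriv_eq_zero_of_notMem_Icc hχ0 (hnotK t p h1 h2 hp)]
  have hd0 : ∀ t ∈ Set.Icc (0 : ℝ) 1, HasDerivAt (fun t ↦ ∫ p in K, Ψ t p ∂(riemannianVolume g))
      (∫ p in K, Ψ' t p ∂(riemannianVolume g)) t := fun t₀ ht₀ ↦ by
    have hle : ∀ t ∈ Set.Icc (t₀ - ε) (t₀ + ε), -ε ≤ t := fun t ht ↦ by linarith [ht.1, ht₀.1]
    refine hasDerivAt_setIntegral_of_isCompact hK hε0 (fun t ht ↦ ?_) ?_ fun t ht p _ ↦ ?_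
    · have hne : ∀ p, F t p ≠ 0 := fun p ↦ (hFpos t p (hle t ht)).ne'
      refine Continuous.continuousOn ?_
      simp only [Ψ, hPe]
      have : Continuous (F t) := by fun_prop
      fun_prop (disch := exact hne)
    · have hne : ∀ q ∈ Set.Icc (t₀ - ε) (t₀ + ε) ×ˢ K, F q.1 q.2 ≠ 0 := fun q hq ↦
        (hFpos _ _ (hle _ hq.1)).ne'
      have hFc : Continuous (fun q : ℝ × M ↦ F q.1 q.2) := by
        simp only [F]
        fun_prop
      have huc : Continuous u := by fun_prop
      have hPc : Continuous (fun q : ℝ × M ↦ P q.1 q.2) := by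
        simp only [hPe]
        fun_prop
      have hQc : Continuous (fun q : ℝ × M ↦ Q q.1 q.2) := by
        simp only [hQe]
        fun_prop
      have h1 : ContinuousOn (fun q : ℝ × M ↦ P q.1 q.2 / F q.1 q.2)
          (Set.Icc (t₀ - ε) (t₀ + ε) ×ˢ K) := hPc.continuousOn.div hFc.continuousOn hne
      have h2 : ContinuousOn (fun q : ℝ × M ↦ Q q.1 q.2 / F q.1 q.2)
          (Set.Icc (t₀ - ε) (t₀ + ε) ×ˢ K) := hQc.continuousOn.div hFc.continuousOn hne
      have h3 : ContinuousOn (fun q : ℝ × M ↦ u q.2 / F q.1 q.2)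
          (Set.Icc (t₀ - ε) (t₀ + ε) ×ˢ K) :=
        (huc.comp continuous_snd).continuousOn.div hFc.continuousOn hne
      have h4 := (hχc'.comp hFc).continuousOn (s := Set.Icc (t₀ - ε) (t₀ + ε) ×ˢ K)
      have h5 := (hχc.comp hFc).continuousOn (s := Set.Icc (t₀ - ε) (t₀ + ε) ×ˢ K)
      exact ((h4.mul hFc.continuousOn).mul (h3.mul h1)).add
        (h5.mul ((continuousOn_const.mul h2).sub (h3.mul h1)))
    · have hne : F t p ≠ 0 := (hFpos t p (hle t ht)).ne'
      have h1 : HasDerivAt (fun t ↦ F t p) (u p) t := by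
        convert! (((hasDerivAt_id t).const_sub 1).mul_const (G p)).add
          ((hasDerivAt_id t).mul_const (H p)) using 1
      have h2 : HasDerivAt (fun t ↦ P t p) (2 * Q t p) t := by
        simp only [hPe, hQe]
        have e1 := hasDerivAt_id t
        have e2 := e1.const_sub 1
        convert! (((e2.mul e2).mul_const (A p)).add
          (((e2.mul e1).add (e1.mul e2)).mul_const (B p))).add
          ((e1.mul e1).mul_const (C p)) using 1
        simp only [id]
        ring
      have h3 : HasDerivAt (fun t ↦ χ (F t p)) (deriv χ (F t p) * u p) t :=
        ((hχ.differentiable (by simp) _).hasDerivAt).comp t h1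
      convert! h3.mul (h2.div h1 hne) using 1
      simp only [Ψ', Pi.div_apply]
      field_simp
  have hmain := le_exp_mul_of_hasDerivAt_le (c := (L - 1) * (d : ℝ) ^ 2 / 2) hd0 fun t ht ↦ by
    have h1 : -ε ≤ t := by linarith [ht.1]
    have h2 : t ≤ 1 + ε := by linarith [ht.2]
    rw [hKint t h1 h2, hKint' t h1 h2]
    refine hc.integral_variation_le (F := F t) (u := u)
      (hG.linearCombination hH _ _ fun p ↦ hFpos t p h1) hχ ha hχ0 hχn
      (HasPosSemidefHessian.linearCombination hG.smooth hH.smooth hGp hHp (by linarith [ht.2]) ht.1)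
      (contMDiff_linearCombination hG.smooth hH.smooth _ _) (fun p ↦ ?_) (fun p ↦ ?_) fun p ↦ ?_
    · rw [mvfderiv_linearCombination hG.smooth hH.smooth, hG.linear, hH.linear]
    · simp only [u]
      linarith [hGH p]
    · have e1 := hGH p
      have e2 := hHG p
      have e3 : G p ≤ F t p := by
        simp only [F]
        nlinarith [mul_nonneg ht.1 (sub_nonneg.2 e1)]
      have e4 := mul_le_mul_of_nonneg_left e3 (by linarith : 0 ≤ L - 1)
      simp only [u]
      linarith
  rw [hKint 0 (by linarith) (by linarith), hKint 1 (by linarith) (by linarith)] at hmain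
  have hF0 : F 0 = G := by
    funext p
    simp [F]
  have hF1 : F 1 = H := by
    funext p
    simp [F]
  simp only [Ψ, P, hF0, hF1] at hmain
  rw [hc.integral_laplacian_eq hG hχ ha hχ0, hc.integral_laplacian_eq hH hχ ha hχ0]
  have h0 : 0 ≤ ∫ p, χ (G p) * (pairing g (grad g G) (grad g G) p / G p) ∂(riemannianVolume g) :=
    integral_nonneg fun p ↦ mul_nonneg (hχn _) (div_nonneg (pairing_self_nonneg _) (hG.pos p).le)
  have h1 : Real.exp ((L - 1) * (d : ℝ) ^ 2 / 2) ≤ Real.exp (L * (d : ℝ) ^ 2 / 2) := by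
    apply Real.exp_le_exp.2
    nlinarith [sq_nonneg (d : ℝ)]
  have h2 := hmain.trans (mul_le_mul_of_nonneg_right h1 h0)
  have h3 := mul_le_mul_of_nonneg_left h2 (by positivity : (0 : ℝ) ≤ (d : ℝ) / 2)
  linarith

end Path

section Cutoff

/-- A smooth cutoff function supported in `[1 / (n + 1), 2]`, which is `1` between `2 / (n + 1)`
and `1` and vanishes from `1 + 1 / (k + 1)` on. -/
noncomputable def cutoff (n k : ℕ) (s : ℝ) : ℝ :=
  Real.smoothTransition ((n + 1) * s - 1) * Real.smoothTransition (1 + (k + 1) * (1 - s))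

variable {n k : ℕ} {s : ℝ}

lemma contDiff_cutoff : ContDiff ℝ ∞ (cutoff n k) :=
  (Real.smoothTransition.contDiff.comp (by fun_prop)).mul
    (Real.smoothTransition.contDiff.comp (by fun_prop))

lemma cutoff_nonneg : 0 ≤ cutoff n k s :=
  mul_nonneg (Real.smoothTransition.nonneg _) (Real.smoothTransition.nonneg _)

lemma cutoff_eq_zero (hs : s ∉ Set.Icc (1 / ((n : ℝ) + 1)) 2) : cutoff n k s = 0 := by
  rw [cutoff]
  rw [Set.mem_Icc, not_and_or, not_le, not_le, lt_div_iff₀ (by positivity)] at hs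
  rcases hs with hs | hs
  · rw [Real.smoothTransition.zero_of_nonpos (by linarith), zero_mul]
  · have : (0 : ℝ) ≤ k := Nat.cast_nonneg k
    rw [Real.smoothTransition.zero_of_nonpos (x := 1 + _) (by nlinarith), mul_zero]

lemma cutoff_eq_right (hs : 2 / ((n : ℝ) + 1) ≤ s) :
    cutoff n k s = Real.smoothTransition (1 + (k + 1) * (1 - s)) := by
  rw [div_le_iff₀ (by positivity)] at hs
  rw [cutoff, Real.smoothTransition.one_of_one_le (by linarith), one_mul]

lemma cutoff_le : cutoff n k s ≤ Real.smoothTransition (2 - s) := by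
  refine (mul_le_of_le_one_left (Real.smoothTransition.nonneg _)
    (Real.smoothTransition.le_one _)).trans ?_
  have : (0 : ℝ) ≤ k := Nat.cast_nonneg k
  rcases le_or_gt s 1 with h | h
  · rw [Real.smoothTransition.one_of_one_le (x := 2 - s) (by linarith)]
    exact Real.smoothTransition.le_one _
  · exact Real.smoothTransition.monotone (by nlinarith)

lemma tendsto_cutoff (hs : 0 < s) :
    Filter.Tendsto (fun n ↦ cutoff n n s) Filter.atTop (nhds (if s ≤ 1 then 1 else 0)) := by
  refine tendsto_const_nhds.congr' ?_
  split_ifs with h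
  · obtain ⟨N, hN⟩ := exists_nat_gt (2 / s)
    filter_upwards [Filter.eventually_ge_atTop N] with n hn
    have h1 : (N : ℝ) ≤ n := Nat.cast_le.2 hn
    rw [div_lt_iff₀ hs] at hN
    have h2 : 2 / ((n : ℝ) + 1) ≤ s := by
      rw [div_le_iff₀ (by positivity)]
      nlinarith
    have h3 : (0 : ℝ) ≤ n := Nat.cast_nonneg n
    rw [cutoff_eq_right h2, Real.smoothTransition.one_of_one_le (by nlinarith)]
  · rw [not_le] at h
    obtain ⟨N, hN⟩ := exists_nat_gt (1 / (s - 1))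
    filter_upwards [Filter.eventually_ge_atTop N] with n hn
    have h1 : (N : ℝ) ≤ n := Nat.cast_le.2 hn
    rw [div_lt_iff₀ (by linarith)] at hN
    rw [cutoff, Real.smoothTransition.zero_of_nonpos (x := 1 + _) (by nlinarith), mul_zero]

end Cutoff

section Limit

variable {d : ℕ} {M : Type*} [TopologicalSpace M] [ChartedSpace (EuclideanSpace ℝ (Fin d)) M]
  [IsManifold (𝓡 d) ∞ M] {g : SmoothMetric (𝓡 d) M} {V : Π x : M, TangentSpace (𝓡 d) x}
  {F : M → ℝ} [MeasurableSpace M] [BorelSpace M] [T2Space M] [SecondCountableTopology M]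
  (hc : IsProperCone g V) (hF : IsPositiveLinear V F)
include hc hF

lemma IsProperCone.exists_integral_cutoff_le :
    ∃ C, ∀ n, ∫ p, cutoff n 0 (F p) * laplacian g F p ∂(riemannianVolume g) ≤ C := by
  have hP := contMDiff_pairing_grad (g := g) hF.smooth hF.smooth
  set w : M → ℝ := fun p ↦ pairing g (grad g F) (grad g F) p / F p with hw
  have hws : ContMDiff (𝓡 d) 𝓘(ℝ) ∞ w := ContMDiff.div_of_pos hP hF.smooth hF.pos
  have hw0 : ∀ p, 0 ≤ w p := fun p ↦ div_nonneg (pairing_self_nonneg _) (hF.pos p).le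
  have hVw : ∀ p, mvfderiv (𝓡 d) w p (V p) = 0 := fun p ↦ hF.mvfderiv_div hP
    (mvfderiv_pairing_grad g (hc.smooth.mdifferentiableAt (by simp)) hc.linear hc.selfAdjoint
      hF.smooth hF.linear hF.smooth hF.linear)
  have hFc := hF.smooth.continuous
  have hwc := hws.continuous
  let ρ : ℝ → ℝ := fun s ↦ Real.smoothTransition (2 - s)
  have hρ : ContDiff ℝ ∞ ρ := Real.smoothTransition.contDiff.comp (by fun_prop)
  have hρ' : Continuous (deriv ρ) := hρ.continuous_deriv (by simp)
  have hρ0 : ∀ s ∉ Set.Icc (1 : ℝ) 2, deriv ρ s = 0 := fun s hs ↦ by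
    rw [Set.mem_Icc, not_and_or, not_le, not_le] at hs
    rcases hs with hs | hs
    · have : ρ =ᶠ[nhds s] fun _ ↦ 1 := by
        filter_upwards [gt_mem_nhds hs] with r hr
        exact Real.smoothTransition.one_of_one_le (by linarith)
      rw [this.deriv_eq, deriv_const]
    · have : ρ =ᶠ[nhds s] fun _ ↦ 0 := by
        filter_upwards [lt_mem_nhds hs] with r hr
        exact Real.smoothTransition.zero_of_nonpos (by linarith)
      rw [this.deriv_eq, deriv_const]
  have hi : Integrable (fun p ↦ |deriv ρ (F p)| * F p * w p) (riemannianVolume g) :=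
    hc.integrable_slab (a := 1) (b := 2) hF (by fun_prop) one_pos fun p hp ↦ by simp [hρ0 _ hp]
  refine ⟨∫ p, |deriv ρ (F p)| * F p * w p ∂(riemannianVolume g), fun n ↦ ?_⟩
  have ha : 0 < 1 / ((n : ℝ) + 1) := by positivity
  have hχ : ContDiff ℝ ∞ (cutoff n 0) := contDiff_cutoff
  have hχ0 : ∀ s ∉ Set.Icc (1 / ((n : ℝ) + 1)) 2, cutoff n 0 s = 0 := fun s ↦ cutoff_eq_zero
  have hχ' : Continuous (deriv (cutoff n 0)) := hχ.continuous_deriv (by simp)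
  rw [hc.integral_laplacian_eq hF hχ ha hχ0]
  have h1 := hc.integral_deriv_mul hF hws hVw hχ ha hχ0
  have h2 : Integrable (fun p ↦ deriv (cutoff n 0) (F p) * F p * w p) (riemannianVolume g) :=
    hc.integrable_slab (b := 2) hF (by fun_prop) ha fun p hp ↦ by
      simp [deriv_eq_zero_of_notMem_Icc hχ0 hp]
  have h3 : (d : ℝ) / 2 * ∫ p, cutoff n 0 (F p) * w p ∂(riemannianVolume g) =
      ∫ p, -(deriv (cutoff n 0) (F p) * F p * w p) ∂(riemannianVolume g) := by
    rw [integral_neg, h1]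
    ring
  rw [h3]
  refine integral_mono h2.neg hi fun p ↦ ?_
  let q : ℝ → ℝ := fun s ↦ Real.smoothTransition ((n + 1) * s - 1)
  have hq : ContDiff ℝ ∞ q := Real.smoothTransition.contDiff.comp (by fun_prop)
  have hqm : Monotone q := fun s t hst ↦ Real.smoothTransition.monotone (by gcongr)
  have h4 : deriv (cutoff n 0) (F p) =
      deriv q (F p) * ρ (F p) + q (F p) * deriv ρ (F p) := by
    have h5 : cutoff n 0 = q * ρ := by
      funext s
      simp only [cutoff, q, ρ, Pi.mul_apply]
      congr 2
      push_cast
      ring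
    rw [h5]
    exact deriv_mul (hq.differentiable (by simp) _) (hρ.differentiable (by simp) _)
  have h5 : 0 ≤ deriv q (F p) * ρ (F p) :=
    mul_nonneg hqm.deriv_nonneg (Real.smoothTransition.nonneg _)
  have h6 : -(q (F p) * deriv ρ (F p)) ≤ |deriv ρ (F p)| := by
    refine (neg_le_abs _).trans ?_
    rw [abs_mul, abs_of_nonneg (Real.smoothTransition.nonneg _)]
    exact mul_le_of_le_one_left (abs_nonneg _) (Real.smoothTransition.le_one _)
  have h7 : -deriv (cutoff n 0) (F p) ≤ |deriv ρ (F p)| := by linarith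
  have h8 := mul_le_mul_of_nonneg_right h7 (mul_nonneg (hF.pos p).le (hw0 p))
  simp only
  linarith

variable (hpsd : HasPosSemidefHessian g F)
include hpsd

lemma IsProperCone.integrable_cutoff_mul_laplacian :
    Integrable (fun p ↦ Real.smoothTransition (2 - F p) * laplacian g F p)
      (riemannianVolume g) := by
  obtain ⟨C, hC⟩ := hc.exists_integral_cutoff_le hF
  have hFc := hF.smooth.continuous
  have hLc := continuous_laplacian (g := g) hF.smooth
  have hσ := Real.smoothTransition.continuous
  have hint : ∀ n k : ℕ, Integrable (fun p ↦ cutoff n k (F p) * laplacian g F p)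
      (riemannianVolume g) := fun n k ↦ by
    have := (contDiff_cutoff (n := n) (k := k)).continuous
    exact hc.integrable_slab (a := 1 / ((n : ℝ) + 1)) (b := 2) hF (by fun_prop) (by positivity)
      fun p hp ↦ by simp [cutoff_eq_zero hp]
  let φ : ℕ → Set M := fun n ↦ {p | 2 / ((n : ℝ) + 1) ≤ F p}
  have hφm : ∀ n, MeasurableSet (φ n) := fun n ↦
    (isClosed_le continuous_const hFc).measurableSet
  have hcover : AECover (riemannianVolume g) Filter.atTop φ :=
    ⟨.of_forall fun p ↦ by
      obtain ⟨N, hN⟩ := exists_nat_gt (2 / F p)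
      filter_upwards [Filter.eventually_ge_atTop N] with n hn
      have h1 : (N : ℝ) ≤ n := Nat.cast_le.2 hn
      rw [div_lt_iff₀ (hF.pos p)] at hN
      change 2 / ((n : ℝ) + 1) ≤ F p
      rw [div_le_iff₀ (by positivity)]
      nlinarith [hF.pos p], hφm⟩
  have heq : ∀ n, ∀ p ∈ φ n, cutoff n 0 (F p) * laplacian g F p =
      Real.smoothTransition (2 - F p) * laplacian g F p := fun n p hp ↦ by
    rw [cutoff_eq_right hp]
    congr 2
    push_cast
    ring
  refine hcover.integrable_of_integral_norm_bounded C (fun n ↦ ?_) (.of_forall fun n ↦ ?_)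
  · exact (hint n 0).integrableOn.congr_fun (heq n) (hφm n)
  · refine le_trans ?_ (hC n)
    rw [← setIntegral_congr_fun (hφm n) fun p hp ↦ congrArg norm (heq n p hp)]
    refine (integral_mono_measure Measure.restrict_le_self (.of_forall fun p ↦ norm_nonneg _)
      (hint n 0).norm).trans_eq ?_
    exact integral_congr_ae (.of_forall fun p ↦ Real.norm_of_nonneg
      (mul_nonneg cutoff_nonneg (laplacian_nonneg g hpsd)))

lemma IsProperCone.integrableOn_laplacian :
    IntegrableOn (laplacian g F) {p | F p ≤ 1} (riemannianVolume g) :=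
  (hc.integrable_cutoff_mul_laplacian hF hpsd).integrableOn.congr_fun (fun p hp ↦ by
    have hp' : F p ≤ 1 := hp
    simp only [Real.smoothTransition.one_of_one_le (by linarith : 1 ≤ 2 - F p), one_mul])
    (isClosed_le hF.smooth.continuous continuous_const).measurableSet

lemma IsProperCone.tendsto_integral_cutoff :
    Filter.Tendsto (fun n ↦ ∫ p, cutoff n n (F p) * laplacian g F p ∂(riemannianVolume g))
      Filter.atTop (nhds (laplacianFunctional g F)) := by
  have hFc := hF.smooth.continuous
  have hLc := continuous_laplacian (g := g) hF.smooth
  rw [laplacianFunctional,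
    ← integral_indicator (isClosed_le hFc continuous_const).measurableSet]
  refine tendsto_integral_of_dominated_convergence
    (fun p ↦ Real.smoothTransition (2 - F p) * laplacian g F p) (fun n ↦ ?_)
    (hc.integrable_cutoff_mul_laplacian hF hpsd) (fun n ↦ .of_forall fun p ↦ ?_)
    (.of_forall fun p ↦ ?_)
  · have := (contDiff_cutoff (n := n) (k := n)).continuous
    exact (by fun_prop : Continuous fun p ↦ cutoff n n (F p) * laplacian g F p).aestronglyMeasurable
  · have h := laplacian_nonneg (p := p) g hpsd
    rw [Real.norm_of_nonneg (mul_nonneg cutoff_nonneg h)]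
    exact mul_le_mul_of_nonneg_right cutoff_le h
  · convert! (tendsto_cutoff (hF.pos p)).mul_const (laplacian g F p) using 2
    simp [Set.indicator_apply]

end Limit

end LaplacianFunctional

theorem mainTheorem7 {d m : ℕ}
    {M : Type*} [TopologicalSpace M] [T2Space M] [SecondCountableTopology M]
    [ChartedSpace (EuclideanSpace ℝ (Fin d)) M] [IsManifold (𝓡 d) ∞ M]
    [MeasurableSpace M] [BorelSpace M]
    {Y : Type*} [TopologicalSpace Y] [CompactSpace Y]
    [ChartedSpace (EuclideanSpace ℝ (Fin m)) Y] [IsManifold (𝓡 m) ∞ Y]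
    (g : LaplacianFunctional.SmoothMetric (𝓡 d) M)
    (V : Π x : M, TangentSpace (𝓡 d) x)
    (hV : ContMDiff (𝓡 d) (𝓡 d).tangent ∞ (fun x ↦ (⟨x, V x⟩ : TangentBundle (𝓡 d) M)))
    (ι : Y → M) (hcyl : LaplacianFunctional.IsCylindrical m V ι)
    (hg : LaplacianFunctional.IsLinearMetric g V 1)
    (hsa : LaplacianFunctional.IsSelfAdjointFor g (LaplacianFunctional.leviCivita g V))
    (G H : M → ℝ)
    (hG : LaplacianFunctional.IsPositiveLinear V G)
    (hH : LaplacianFunctional.IsPositiveLinear V H)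
    (hGpsd : LaplacianFunctional.HasPosSemidefHessian g G)
    (hHpsd : LaplacianFunctional.HasPosSemidefHessian g H)
    (L : ℝ) (hL : 1 ≤ L) (hGH : ∀ p, G p ≤ H p) (hHG : ∀ p, H p ≤ L * G p) :
    MeasureTheory.IntegrableOn (LaplacianFunctional.laplacian g G) {p | G p ≤ 1}
        (LaplacianFunctional.riemannianVolume g) ∧
      MeasureTheory.IntegrableOn (LaplacianFunctional.laplacian g H) {p | H p ≤ 1}
        (LaplacianFunctional.riemannianVolume g) ∧
      LaplacianFunctional.laplacianFunctional g H ≤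
        Real.exp (L * (d : ℝ) ^ 2 / 2) * LaplacianFunctional.laplacianFunctional g G := by
  have hc : LaplacianFunctional.IsProperCone g V :=
    ⟨hV, hg, hsa, fun F hF a b ha ↦ hF.isCompact_slab hcyl ha⟩
  refine ⟨hc.integrableOn_laplacian hG hGpsd, hc.integrableOn_laplacian hH hHpsd, ?_⟩
  refine le_of_tendsto_of_tendsto' (hc.tendsto_integral_cutoff hH hHpsd)
    ((hc.tendsto_integral_cutoff hG hGpsd).const_mul _) fun n ↦ ?_
  exact hc.integral_laplacian_le hG hH hGpsd hHpsd hL hGH hHG LaplacianFunctional.contDiff_cutoff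
    (by positivity : 0 < 1 / ((n : ℝ) + 1)) (fun s ↦ LaplacianFunctional.cutoff_eq_zero)
    fun s ↦ LaplacianFunctional.cutoff_nonneg
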